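/- Let $(\xi_t)_{t\in\mathbb Z}$ be i.i.d. real random variables with $\|\xi_0\|_1=\mathbb E|\xi_0|<\infty$, such that $0$ is the unique median of $\xi_0$ and $\mathbb P(\xi_0=0)<1$. Let $0<r<1$, $\Theta=[-r,r]$, and let $\theta^{(n)}_t\in\Theta$ ($1\le t\le n$, $n\ge 1$) satisfy the local stationarity assumption LS($\rho$) for some $\rho\in(0,1]$: there are $K_\theta>0$ and a continuous $\theta^*:[0,1]\to\mathbb R$ with $$|\theta^{(n)}_t-\theta^*(u)|\le K_\theta\,\Big|u-\frac tn\Big|^{\rho}\qquad\text{for all } n\ge1,\ 1\le t\le n,\ u\in[0,1].$$ Let $X^{(n)}_t=0$ for $t\le 0$ and $X^{(n)}_t=\theta^{(n)}_tX^{(n)}_{t-1}+\xi_t$ for $1\le t\le n$ (the tvAR(1) process). Let $K:\mathbb R\to\mathbb R$ be bounded, compactly supported, differentiable outside a finite set, with $\int_{\mathbb R}K(x)\,dx=1$, and let $h_n>0$ with $h_n\to0$. For $n\ge 1$ and $u\in(0,1)$ let the localized least absolute value (LAV) estimator $\widehat\theta_n(u)$ be any minimizer over $\theta\in\Theta$ of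 $$\frac1{nh_n}\sum_{j=1}^n\big|X^{(n)}_j-\theta X^{(n)}_{j-1}\big|\,K\Big(\frac{j/n-u}{h_n}\Big).$$ Then: 1. if $nh_n\to\infty$, then $\widehat\theta_n(u)\to\theta^*(u)$ in probability for every $u\in(0,1)$; 2. if, for some $p>1$, $\|\xi_0\|_p<\infty$ and $n^{1-1/p}h_n\to\infty$, then for every $\varepsilon>0$ $$\sup_{u\in[\varepsilon,1-\varepsilon]}\big|\widehat\theta_n(u)-\theta^*(u)\big|\longrightarrow0\quad\text{in probability.}$$ (No measurability of the minimizer is required; convergence in probability is understood with the outer probability where needed.) -/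

import Mathlib

open MeasureTheory ProbabilityTheory Filter Topology Set

namespace LocallyStationaryAR

noncomputable section

variable {Ω : Type*}

/-- Auxiliary recursion on the natural numbers: `x₀ = 0`, `x_{t+1} = a_{t+1} x_t + e_{t+1}`. -/
def ar1Rec (a : ℕ → ℝ) (e : ℤ → ℝ) : ℕ → ℝ
  | 0 => 0
  | t + 1 => a (t + 1) * ar1Rec a e t + e ((t : ℤ) + 1)

/-- The tvAR(1) array `X_t^{(n)}` with coefficients `θ n t` and innovations `ξ t`:
`X_t^{(n)} = 0` for `t ≤ 0` and `X_t^{(n)} = θ_t^{(n)} X_{t-1}^{(n)} + ξ_t` for `t ≥ 1`. -/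
def tvAR1 (θ : ℕ → ℕ → ℝ) (ξ : ℤ → Ω → ℝ) (n : ℕ) (t : ℤ) (ω : Ω) : ℝ :=
  ar1Rec (θ n) (fun s => ξ s ω) t.toNat

theorem tvAR1_of_nonpos (θ : ℕ → ℕ → ℝ) (ξ : ℤ → Ω → ℝ) (n : ℕ) {t : ℤ} (ht : t ≤ 0) (ω : Ω) :
    tvAR1 θ ξ n t ω = 0 := by
  simp [tvAR1, Int.toNat_of_nonpos ht, ar1Rec]

theorem tvAR1_of_pos (θ : ℕ → ℕ → ℝ) (ξ : ℤ → Ω → ℝ) (n t : ℕ) (ht : 1 ≤ t) (ω : Ω) :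
    tvAR1 θ ξ n t ω = θ n t * tvAR1 θ ξ n ((t : ℤ) - 1) ω + ξ t ω := by
  obtain ⟨s, rfl⟩ : ∃ s, t = s + 1 := ⟨t - 1, by omega⟩
  have h1 : (((s + 1 : ℕ) : ℤ)).toNat = s + 1 := by omega
  have h2 : (((s + 1 : ℕ) : ℤ) - 1).toNat = s := by omega
  simp only [tvAR1, h1, h2, ar1Rec]
  push_cast
  rfl

/-- Assumption (LS(ρ)): the array `θ n t` (`1 ≤ t ≤ n`) is approximated by the continuous function
`θstar` on `[0, 1]`, with Hölder exponent `ρ`. -/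
def LocallyStationary (ρ : ℝ) (θ : ℕ → ℕ → ℝ) (θstar : ℝ → ℝ) : Prop :=
  ContinuousOn θstar (Icc 0 1) ∧
    ∃ C : ℝ, 0 < C ∧ ∀ n : ℕ, 1 ≤ n → ∀ t : ℕ, 1 ≤ t → t ≤ n → ∀ u ∈ Icc (0 : ℝ) 1,
      |θ n t - θstar u| ≤ C * |u - (t : ℝ) / n| ^ ρ

/-- Localizing kernels: compactly supported, bounded, differentiable off a finite set, of
integral one. The kernel may change sign. -/
structure IsLocalizingKernel (K : ℝ → ℝ) : Prop where
  compact_support : ∃ c : ℝ, 0 < c ∧ ∀ x : ℝ, c ≤ |x| → K x = 0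
  piecewise_differentiable : ∃ S : Finset ℝ, ∀ x : ℝ, x ∉ S → DifferentiableAt ℝ K x
  integral_eq_one : ∫ x, K x = 1
  bounded : ∃ C : ℝ, ∀ x : ℝ, |K x| ≤ C

/-- The least absolute value contrast. The sequence `x = (x 0, x 1, …)` lists the present value
first, then the past: `Φ_LAV(x, θ) = |x 0 - θ * x 1|`. -/
def lavContrast (x : ℕ → ℝ) (θ : ℝ) : ℝ := |x 0 - θ * x 1|

/-- The localized empirical contrast at `u` of a sample `X_1, …, X_n` (with its past `X_t`, `t ≤ 0`)
with bandwidth `h`: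
`(n h)⁻¹ ∑_{j=1}^n Φ((X_{j-i})_{i ≥ 0}, θ) K((j/n - u)/h)`. -/
def localizedContrast (Φ : (ℕ → ℝ) → ℝ → ℝ) (K : ℝ → ℝ) (h : ℝ) (n : ℕ) (X : ℤ → ℝ)
    (u θ : ℝ) : ℝ :=
  1 / (n * h) * ∑ j ∈ Finset.Icc 1 n,
    Φ (fun i : ℕ => X ((j : ℤ) - (i : ℤ))) θ * K (((j : ℝ) / n - u) / h)

/-- `θhat` is (a version of) the localized LAV estimator with parameter set `Θ = [-r, r]`: for
every `n ≥ 1`, `u ∈ (0, 1)` and outcome `ω` it is a point of `Θ` at which the localized LAV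
contrast attains its minimum over `Θ`. -/
def IsLocalizedLAVEstimator (r : ℝ) (K : ℝ → ℝ) (h : ℕ → ℝ) (X : ℕ → ℤ → Ω → ℝ)
    (θhat : ℕ → ℝ → Ω → ℝ) : Prop :=
  ∀ n : ℕ, 1 ≤ n → ∀ u ∈ Ioo (0 : ℝ) 1, ∀ ω : Ω,
    θhat n u ω ∈ Icc (-r) r ∧
      IsMinOn (localizedContrast lavContrast K (h n) n (fun t => X n t ω) u) (Icc (-r) r)
        (θhat n u ω)

/-- `m` is a median of the real random variable `Y`. -/
def IsMedian [MeasurableSpace Ω] (μ : Measure Ω) (Y : Ω → ℝ) (m : ℝ) : Prop :=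
  1 / 2 ≤ μ {ω | Y ω ≤ m} ∧ 1 / 2 ≤ μ {ω | m ≤ Y ω}

end

end LocallyStationaryAR

/-! For times `j` near `n u` the coefficients are close to `θ*(u)`, so `X_{j-1}` is close to a
moving average `V_{j-1}` of its last `k` innovations with the frozen coefficient `θ*(u)`. Hence
`|X_j - a X_{j-1}|` is close to `|ξ_j + (θ*(u) - a) V_{j-1}|`, and the localized contrast at `a`
should approach `g(a) = E|ξ_0 + (θ*(u) - a) V_{-1}|`. As `V_{-1}` is independent of `ξ_0` and `0` is
the only median of `ξ_0`, `g` is minimal at `a = θ*(u)`, with a gap `γ > 0` outside any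
`η`-neighbourhood that depends neither on `k` nor on `θ*(u)` (`exists_gap`). Once the contrast is
within `γ/3` of `g`, its minimizer must lie in that neighbourhood. The sign of `K` plays no role:
only the limit `g` needs a minimum, and the weights only need total mass tending to `1` and size
`O(1/(n h))`.

Closeness to `g` is proved with innovations truncated at a level `B`. The deterministic comparison
`abs_lav_sub_frozenContrast_le` bounds every approximation error by geometric averages of `|ξ|` and
of the truncated parts. The frozen truncated contrast is bounded and finitely dependent, so
Hoeffding's inequality `measure_abs_sum_ge_le_of_dependsOn` bounds its fluctuations exponentially in
`n h`. Kernel weights are first recentred from `n u` to `⌊n u⌋`, so that a union bound over at most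
`n + 1` centres is enough for uniformity in `u`.

The truncated parts are the only place where moments matter. At a single `u`, Markov's inequality
and `E|ξ_0| < ∞` suffice (`negligibleTails_singleton`). Uniformly in `u`, a Fuk–Nagaev bound for
maxima of block sums gives an error of order `n / (n h)^p`, which tends to `0` exactly when
`n^{1-1/p} h → ∞` (`negligibleTails_of_memLp`). These estimates are assembled in
`exists_net_eventually_measure_le`. -/

namespace LocallyStationaryAR

/-! ### Comparison of the recursion with a frozen moving average -/

/-- The finite moving average `∑_{i<k} a^i e_{t-i}`. -/
def movAvg (a : ℝ) (e : ℤ → ℝ) (k : ℕ) (t : ℤ) : ℝ :=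
  ∑ i ∈ Finset.range k, a ^ i * e (t - i)

/-- The geometrically weighted sum `∑_{l=1}^t s^{t-l} w_l`. -/
def geomSum (s : ℝ) (w : ℤ → ℝ) (t : ℕ) : ℝ := ar1Rec (fun _ => s) w t

theorem movAvg_zero (a : ℝ) (e : ℤ → ℝ) (t : ℤ) : movAvg a e 0 t = 0 := by
  simp [movAvg]

theorem movAvg_succ (a : ℝ) (e : ℤ → ℝ) (k : ℕ) (t : ℤ) :
    movAvg a e (k + 1) t = e t + a * movAvg a e k (t - 1) := by
  simp only [movAvg, Finset.sum_range_succ', Finset.mul_sum]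
  rw [add_comm]
  congr 1
  · simp
  · refine Finset.sum_congr rfl fun i _ => ?_
    have : t - ((i + 1 : ℕ) : ℤ) = t - 1 - i := by push_cast; ring
    rw [this]; ring

theorem movAvg_sub (a : ℝ) (e f : ℤ → ℝ) (k : ℕ) (t : ℤ) :
    movAvg a e k t - movAvg a f k t = movAvg a (fun l => e l - f l) k t := by
  simp only [movAvg, ← Finset.sum_sub_distrib]
  exact Finset.sum_congr rfl fun i _ => by ring

theorem geomSum_succ (s : ℝ) (w : ℤ → ℝ) (t : ℕ) :
    geomSum s w (t + 1) = s * geomSum s w t + w ((t : ℤ) + 1) := rfl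

theorem geomSum_nonneg {s : ℝ} (hs : 0 ≤ s) {w : ℤ → ℝ} (hw : ∀ l, 0 ≤ w l) (t : ℕ) :
    0 ≤ geomSum s w t := by
  induction t with
  | zero => exact le_rfl
  | succ t ih => rw [geomSum_succ]; have := hw (t + 1); positivity

theorem abs_ar1Rec_le_geomSum {s : ℝ} (a : ℕ → ℝ) (e : ℤ → ℝ) (t : ℕ)
    (ha : ∀ l, 1 ≤ l → l ≤ t → |a l| ≤ s) :
    |ar1Rec a e t| ≤ geomSum s (fun l => |e l|) t := by
  induction t with
  | zero => simp [ar1Rec, geomSum]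
  | succ t ih =>
    have h1 := ih fun l hl hlt => ha l hl (by omega)
    have h2 := ha (t + 1) (by omega) le_rfl
    rw [geomSum_succ, ar1Rec]
    refine (abs_add_le _ _).trans ?_
    rw [abs_mul]
    gcongr
    exact (abs_nonneg _).trans h2

theorem abs_movAvg_le_geomSum {s a : ℝ} (ha : |a| ≤ s) (e : ℤ → ℝ) (k t : ℕ) (hk : k ≤ t) :
    |movAvg a e k t| ≤ geomSum s (fun l => |e l|) t := by
  have hs : 0 ≤ s := (abs_nonneg _).trans ha
  induction k generalizing t with
  | zero => simpa [movAvg_zero] using geomSum_nonneg hs (fun l => abs_nonneg (e l)) t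
  | succ k ih =>
    obtain ⟨t, rfl⟩ : ∃ u, t = u + 1 := ⟨t - 1, by omega⟩
    have h1 := ih t (by omega)
    rw [geomSum_succ, movAvg_succ]
    have h2 : (((t + 1 : ℕ) : ℤ) - 1) = t := by push_cast; ring
    rw [h2, add_comm]
    refine (abs_add_le _ _).trans ?_
    rw [abs_mul]
    push_cast
    gcongr

/-- Comparison of a tvAR(1) recursion with the moving average of a frozen coefficient. -/
theorem abs_ar1Rec_sub_movAvg_le {r s a D : ℝ} (hr : 0 ≤ r) (hrs : r ≤ s) (hs : 0 < s)
    (hD : 0 ≤ D) (ha : |a| ≤ r) (θ : ℕ → ℝ) (e : ℤ → ℝ) (k t : ℕ) (hk : k ≤ t)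
    (hθ : ∀ l, 1 ≤ l → l ≤ t → |θ l| ≤ r) (hθa : ∀ l, t < l + k → l ≤ t → |θ l - a| ≤ D) :
    |ar1Rec θ e t - movAvg a e k t| ≤
      ((r / s) ^ k + k * D / s) * geomSum s (fun l => |e l|) t := by
  induction k generalizing t with
  | zero =>
    simpa [movAvg_zero] using
      abs_ar1Rec_le_geomSum θ e t fun l h1 h2 => (hθ l h1 h2).trans hrs
  | succ k ih =>
    obtain ⟨t, rfl⟩ : ∃ u, t = u + 1 := ⟨t - 1, by omega⟩
    have h1 := ih t (by omega) (fun l hl hlt => hθ l hl (by omega))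
      (fun l hl hlt => hθa l (by omega) (by omega))
    have h2 : (((t + 1 : ℕ) : ℤ) - 1) = t := by push_cast; ring
    have h3 := abs_movAvg_le_geomSum (ha.trans hrs) e k t (by omega)
    have h4 := hθ (t + 1) (by omega) le_rfl
    have h5 := hθa (t + 1) (by omega) le_rfl
    set S := geomSum s (fun l => |e l|) t
    have hS : 0 ≤ S := geomSum_nonneg hs.le (fun l => abs_nonneg (e l)) t
    -- Going back one time unit costs a factor `1 / s` in the dominating sum while the error itself
    -- is multiplied by at most `r`. The net factor `r / s` per step produces `(r / s) ^ k`; this is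
    -- why `s` is kept separate from `r`.
    have h6 : S ≤ geomSum s (fun l => |e l|) (t + 1) / s := by
      rw [le_div_iff₀ hs, geomSum_succ]
      have := abs_nonneg (e (t + 1))
      simp only [S] at *
      linarith [mul_comm (geomSum s (fun l => |e l|) t) s]
    have h7 : ar1Rec θ e (t + 1) - movAvg a e (k + 1) ((t + 1 : ℕ) : ℤ) =
        θ (t + 1) * (ar1Rec θ e t - movAvg a e k t) + (θ (t + 1) - a) * movAvg a e k t := by
      rw [movAvg_succ, h2, ar1Rec]; push_cast; ring
    rw [h7]
    calc _ ≤ |θ (t + 1)| * |ar1Rec θ e t - movAvg a e k t|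
          + |θ (t + 1) - a| * |movAvg a e k t| := by
          rw [← abs_mul, ← abs_mul]; exact abs_add_le _ _
      _ ≤ r * (((r / s) ^ k + k * D / s) * S) + D * S := by gcongr
      _ = (r * (r / s) ^ k + (r * (k * D / s) + D)) * S := by ring
      _ ≤ (r * (r / s) ^ k + (s * (k * D / s) + D)) * S := by gcongr
      _ ≤ (r * (r / s) ^ k + (s * (k * D / s) + D)) *
            (geomSum s (fun l => |e l|) (t + 1) / s) := by gcongr
      _ = _ := by
          rw [pow_succ (r / s) k]
          push_cast
          generalize (r / s) ^ k = q
          field_simp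

/-! ### Frozen contrast and truncation -/

/-- The absolute innovation plus a multiple of a finite moving average of the past. -/
def frozenContrast (a₀ a : ℝ) (k : ℕ) (e : ℤ → ℝ) (j : ℤ) : ℝ :=
  |e j + (a₀ - a) * movAvg a₀ e k (j - 1)|

/-- Truncation at level `B`. -/
def clip (B x : ℝ) : ℝ := max (-B) (min B x)

theorem abs_clip_le {B : ℝ} (hB : 0 ≤ B) (x : ℝ) : |clip B x| ≤ B := by
  rw [clip, abs_le]
  exact ⟨le_max_left _ _, max_le (by linarith) (min_le_left _ _)⟩

theorem abs_clip_le_abs {B : ℝ} (hB : 0 ≤ B) (x : ℝ) : |clip B x| ≤ |x| := by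
  rw [clip]; grind

theorem abs_sub_clip_le_abs {B : ℝ} (hB : 0 ≤ B) (x : ℝ) : |x - clip B x| ≤ |x| := by
  rw [clip]; grind

theorem abs_sub_clip_eq_zero {B x : ℝ} (hx : |x| ≤ B) : |x - clip B x| = 0 := by
  rw [clip]; grind

theorem abs_le_add_abs_sub_clip {B : ℝ} (hB : 0 ≤ B) (x : ℝ) :
    |x| ≤ B + |x - clip B x| := by
  have := abs_clip_le hB x
  have h2 := abs_add_le (clip B x) (x - clip B x)
  rw [add_sub_cancel] at h2
  linarith

theorem continuous_clip (B : ℝ) : Continuous (clip B) := by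
  unfold clip; fun_prop

theorem geomSum_mono {s : ℝ} (hs : 0 ≤ s) {w w' : ℤ → ℝ} (hw : ∀ l, w l ≤ w' l) (t : ℕ) :
    geomSum s w t ≤ geomSum s w' t := by
  induction t with
  | zero => exact le_rfl
  | succ t ih => rw [geomSum_succ, geomSum_succ]; gcongr; exact hw _

theorem geomSum_const_add_le {s B : ℝ} (hs : 0 ≤ s) (hs1 : s < 1) (hB : 0 ≤ B) (w : ℤ → ℝ)
    (t : ℕ) : geomSum s (fun l => B + w l) t ≤ B / (1 - s) + geomSum s w t := by
  have h1 : 0 < 1 - s := by linarith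
  induction t with
  | zero => simp only [geomSum, ar1Rec]; positivity
  | succ t ih =>
    rw [geomSum_succ, geomSum_succ]
    have : s * (B / (1 - s)) + B = B / (1 - s) := by field_simp; ring
    nlinarith [mul_le_mul_of_nonneg_left ih hs]

theorem abs_movAvg_le {a B : ℝ} (ha : |a| ≤ 1) {e : ℤ → ℝ} (he : ∀ l, |e l| ≤ B) (k : ℕ)
    (t : ℤ) : |movAvg a e k t| ≤ k * B := by
  refine (Finset.abs_sum_le_sum_abs _ _).trans ?_
  have : ∀ i ∈ Finset.range k, |a ^ i * e (t - i)| ≤ B := fun i _ => by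
    rw [abs_mul, abs_pow]
    have h1 : |a| ^ i ≤ 1 := pow_le_one₀ (abs_nonneg _) ha
    nlinarith [he (t - i), abs_nonneg (e (t - i))]
  simpa using Finset.sum_le_sum this

theorem frozenContrast_nonneg (a₀ a : ℝ) (k : ℕ) (e : ℤ → ℝ) (j : ℤ) :
    0 ≤ frozenContrast a₀ a k e j := abs_nonneg _

theorem frozenContrast_le {a₀ a B : ℝ} (ha₀ : |a₀| ≤ 1) (ha : |a| ≤ 1) {e : ℤ → ℝ}
    (he : ∀ l, |e l| ≤ B) (k : ℕ) (j : ℤ) :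
    frozenContrast a₀ a k e j ≤ B + 2 * (k * B) := by
  refine (abs_add_le _ _).trans ?_
  rw [abs_mul]
  have h1 : |a₀ - a| ≤ 2 := (abs_sub _ _).trans (by linarith)
  gcongr
  · exact he j
  · exact abs_movAvg_le ha₀ he k _

theorem abs_frozenContrast_sub_le {a₀ a : ℝ} (ha₀ : |a₀| ≤ 1) (ha : |a| ≤ 1) (e f : ℤ → ℝ)
    (k : ℕ) (j : ℤ) :
    |frozenContrast a₀ a k e j - frozenContrast a₀ a k f j| ≤
      |e j - f j| + 2 * |movAvg a₀ (fun l => e l - f l) k (j - 1)| := by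
  refine (abs_abs_sub_abs_le _ _).trans ?_
  have : e j + (a₀ - a) * movAvg a₀ e k (j - 1) - (f j + (a₀ - a) * movAvg a₀ f k (j - 1)) =
      (e j - f j) + (a₀ - a) * movAvg a₀ (fun l => e l - f l) k (j - 1) := by
    rw [← movAvg_sub]; ring
  rw [this]
  refine (abs_add_le _ _).trans ?_
  rw [abs_mul]
  have h1 : |a₀ - a| ≤ 2 := (abs_sub _ _).trans (by linarith)
  gcongr

/-- Comparison of the LAV contrast of a tvAR(1) recursion with the frozen contrast of the truncated
innovations. -/
theorem abs_lav_sub_frozenContrast_le {r s a₀ a τ D d B : ℝ} (hr : 0 ≤ r) (hrs : r ≤ s)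
    (hs : 0 < s) (hs1 : s ≤ 1) (hD : 0 ≤ D) (ha₀ : |a₀| ≤ r) (ha : |a| ≤ r)
    (hτ : |τ - a| ≤ d) (θ : ℕ → ℝ) (e : ℤ → ℝ) (k t : ℕ) (hk : k ≤ t)
    (hθ : ∀ l, 1 ≤ l → l ≤ t + 1 → |θ l| ≤ r)
    (hθa : ∀ l, t < l + k → l ≤ t + 1 → |θ l - a₀| ≤ D) :
    |(|ar1Rec θ e (t + 1) - τ * ar1Rec θ e t|) -
      frozenContrast a₀ a k (fun l => clip B (e l)) ((t + 1 : ℕ) : ℤ)| ≤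
      (D + d + 2 * ((r / s) ^ k + k * D / s)) / s * geomSum s (fun l => |e l|) (t + 1) +
      2 / s * geomSum s (fun l => |e l - clip B (e l)|) (t + 1) := by
  have hd : 0 ≤ d := (abs_nonneg _).trans hτ
  have h2 : (((t + 1 : ℕ) : ℤ) - 1) = t := by push_cast; ring
  set S := geomSum s (fun l => |e l|) t with hSdef
  have hS : 0 ≤ S := geomSum_nonneg hs.le (fun l => abs_nonneg (e l)) t
  have h6 : S ≤ geomSum s (fun l => |e l|) (t + 1) / s := by
    rw [le_div_iff₀ hs, geomSum_succ]
    have := abs_nonneg (e (t + 1))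
    linarith [mul_comm S s]
  set W := geomSum s (fun l => |e l - clip B (e l)|) t with hWdef
  have hW : 0 ≤ W := geomSum_nonneg hs.le (fun l => abs_nonneg (e l - clip B (e l))) t
  have hX := abs_ar1Rec_le_geomSum (s := s) θ e t fun l h1 h2 => (hθ l h1 (by omega)).trans hrs
  have hXV := abs_ar1Rec_sub_movAvg_le hr hrs hs hD ha₀ θ e k t hk
    (fun l h1 h2 => hθ l h1 (by omega)) (fun l h1 h2 => hθa l h1 (by omega))
  have hθ1 := hθa (t + 1) (by omega) le_rfl
  have e1 : |(|ar1Rec θ e (t + 1) - τ * ar1Rec θ e t|) -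
      frozenContrast a₀ a k e ((t + 1 : ℕ) : ℤ)| ≤
      (D + d + 2 * ((r / s) ^ k + k * D / s)) * S := by
    refine (abs_abs_sub_abs_le _ _).trans ?_
    -- Three errors: the coefficient at the present time (`D`), the parameter (`d`), and the
    -- replacement of the past value by a moving average, whose factor `a₀ - a` has modulus at most
    -- `2`.
    have : ar1Rec θ e (t + 1) - τ * ar1Rec θ e t -
        (e ((t + 1 : ℕ) : ℤ) + (a₀ - a) * movAvg a₀ e k (((t + 1 : ℕ) : ℤ) - 1)) =
        (θ (t + 1) - a₀) * ar1Rec θ e t + (-(τ - a)) * ar1Rec θ e t +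
          (a₀ - a) * (ar1Rec θ e t - movAvg a₀ e k t) := by
      rw [h2, ar1Rec]; push_cast; ring
    rw [this]
    refine (abs_add_three _ _ _).trans ?_
    rw [abs_mul, abs_mul, abs_mul, abs_neg]
    have h1 : |a₀ - a| ≤ 2 := (abs_sub _ _).trans (by linarith)
    calc _ ≤ D * S + d * S + 2 * (((r / s) ^ k + k * D / s) * S) := by gcongr
      _ = _ := by ring
  have e2 := abs_frozenContrast_sub_le (ha₀.trans (hrs.trans hs1)) (ha.trans (hrs.trans hs1)) e
    (fun l => clip B (e l)) k ((t + 1 : ℕ) : ℤ)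
  rw [h2] at e2
  have e3 := abs_movAvg_le_geomSum (ha₀.trans hrs) (fun l => e l - clip B (e l)) k t hk
  have e4 : |e ((t + 1 : ℕ) : ℤ) - clip B (e ((t + 1 : ℕ) : ℤ))| + 2 * W ≤
      2 / s * geomSum s (fun l => |e l - clip B (e l)|) (t + 1) := by
    rw [geomSum_succ]
    push_cast
    have h8 := abs_nonneg (e ((t : ℤ) + 1) - clip B (e ((t : ℤ) + 1)))
    have h7 : 1 ≤ 2 / s := by rw [le_div_iff₀ hs]; linarith
    have : 2 / s * (s * W + |e ((t : ℤ) + 1) - clip B (e ((t : ℤ) + 1))|) =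
      2 * W + 2 / s * |e ((t : ℤ) + 1) - clip B (e ((t : ℤ) + 1))| := by field_simp
    rw [this]
    nlinarith
  have e5 : (D + d + 2 * ((r / s) ^ k + k * D / s)) * S ≤
      (D + d + 2 * ((r / s) ^ k + k * D / s)) / s * geomSum s (fun l => |e l|) (t + 1) := by
    calc _ ≤ (D + d + 2 * ((r / s) ^ k + k * D / s)) *
          (geomSum s (fun l => |e l|) (t + 1) / s) := by gcongr
      _ = _ := by ring
  refine (abs_sub_le _ (frozenContrast a₀ a k e ((t + 1 : ℕ) : ℤ)) _).trans ?_
  exact add_le_add (e1.trans e5) (e2.trans (by linarith))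

/-! ### Concentration for finitely dependent sequences -/

/-- The joint law of an independent family is a product measure, and regrouping its factors along
the blocks gives a product of product measures. -/
theorem iIndepFun_curry {Ω ι κ ι' E : Type*} [MeasurableSpace Ω] [MeasurableSpace E]
    {μ : Measure Ω} {X : ι' → Ω → E} (hX : ∀ i, Measurable (X i)) (h : iIndepFun X μ)
    (g : ι → κ → ι') (hg : Function.Injective fun p : ι × κ => g p.1 p.2) :
    iIndepFun (fun i ω (j : κ) => X (g i j) ω) μ := by
  have := h.isProbabilityMeasure
  have h1 : iIndepFun (fun p : (_ : ι) × κ => X (g p.1 p.2)) μ :=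
    h.precomp (g := fun p : (_ : ι) × κ => g p.1 p.2) fun p q hpq => by
      have := @hg (p.1, p.2) (q.1, q.2) hpq
      simp only [Prod.mk.injEq] at this
      exact Sigma.ext this.1 (heq_of_eq this.2)
  have hP : ∀ i j, IsProbabilityMeasure (μ.map (X (g i j))) :=
    fun i j => Measure.isProbabilityMeasure_map (hX _).aemeasurable
  rw [iIndepFun_iff_map_fun_eq_infinitePi_map (fun i => by fun_prop)]
  have h2 : ∀ i, μ.map (fun ω (j : κ) => X (g i j) ω) =
      Measure.infinitePi fun j => μ.map (X (g i j)) := fun i =>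
    (h1.precomp (g := fun j : κ => (⟨i, j⟩ : (_ : ι) × κ)) fun a b hab => by
      simpa using hab).map_fun_eq_infinitePi_map (fun j => hX _)
  simp_rw [h2]
  rw [← Measure.infinitePi_map_piCurry (fun i j => μ.map (X (g i j))),
    ← h1.map_fun_eq_infinitePi_map (fun p => hX _), Measure.map_map (by fun_prop) (by fun_prop)]
  rfl

theorem identDistrib_shift {Ω E : Type*} [MeasurableSpace Ω] [MeasurableSpace E]
    {μ : Measure Ω} {ξ : ℤ → Ω → E} (hm : ∀ t, Measurable (ξ t)) (hi : iIndepFun ξ μ)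
    (hd : ∀ t, IdentDistrib (ξ t) (ξ 0) μ μ) (j : ℤ) :
    IdentDistrib (fun ω l => ξ (l + j) ω) (fun ω l => ξ l ω) μ μ := by
  refine ⟨by fun_prop, by fun_prop, ?_⟩
  rw [(hi.precomp (g := fun l => l + j) (add_left_injective j)).map_fun_eq_infinitePi_map
    (fun l => hm _), hi.map_fun_eq_infinitePi_map hm]
  congr 1
  ext1 l
  rw [(hd (l + j)).map_eq, (hd l).map_eq]

theorem hasSubgaussianMGF_mono {Ω : Type*} [MeasurableSpace Ω] {μ : Measure Ω} {X : Ω → ℝ}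
    {c d : NNReal} (h : HasSubgaussianMGF X c μ) (hcd : c ≤ d) : HasSubgaussianMGF X d μ :=
  ⟨h.integrable_exp_mul, fun t => (h.mgf_le t).trans (by gcongr)⟩

/-- Hoeffding's inequality for weighted sums of a bounded finitely dependent stationary sequence. -/
theorem measure_abs_sum_ge_le_of_dependsOn {Ω : Type*} [MeasurableSpace Ω] {μ : Measure Ω}
    [IsProbabilityMeasure μ] {ξ : ℤ → Ω → ℝ} (hm : ∀ t, Measurable (ξ t)) (hi : iIndepFun ξ μ)
    (F : (ℤ → ℝ) → ℝ) (hF : Measurable F) (k : ℕ) (hdep : DependsOn F (Icc (-(k : ℤ)) 0))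
    (b : ℝ) (hb : ∀ x, F x ∈ Icc 0 b) (J : Finset ℕ) (q : ℕ → ℝ) (V : ℝ)
    (hV : ∑ j ∈ J, q j ^ 2 * b ^ 2 ≤ V) (t : ℝ) (ht : 0 ≤ t) :
    μ.real {ω | t ≤ |∑ j ∈ J, q j * (F (fun l => ξ (l + j) ω) -
      ∫ ω, F (fun l => ξ (l + j) ω) ∂μ)|} ≤
      2 * (k + 1) * Real.exp (-(t / (k + 1)) ^ 2 / (2 * V)) := by
  set L : ℕ := k + 1 with hL
  have hV0 : 0 ≤ V := (Finset.sum_nonneg fun j _ => by positivity).trans hV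
  set Z : ℕ → Ω → ℝ := fun j ω => q j * (F (fun l => ξ (l + j) ω) -
      ∫ ω, F (fun l => ξ (l + j) ω) ∂μ) with hZ
  have hsub : ∀ j, HasSubgaussianMGF (Z j) (Real.toNNReal (q j ^ 2 * b ^ 2)) μ := fun j => by
    have h1 := (hasSubgaussianMGF_of_mem_Icc (μ := μ) (a := 0) (b := b)
      (X := fun ω => F (fun l => ξ (l + j) ω)) (by fun_prop)
      (ae_of_all _ fun ω => hb _)).const_mul (q j)
    refine hasSubgaussianMGF_mono h1 ?_
    rw [Real.le_toNNReal_iff_coe_le (by positivity)]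
    change q j ^ 2 * (‖b - 0‖ / 2) ^ 2 ≤ _
    rw [sub_zero, div_pow, Real.norm_eq_abs, sq_abs]
    gcongr
    nlinarith [sq_nonneg b]
  -- The variable `Z j` only looks at times in `[j - k, j]`. For indices congruent modulo `L = k +
  -- 1` these windows are disjoint, so each residue class is an independent family.
  have hclass : ∀ a, iIndepFun (fun (j : {j : ℕ // j % L = a}) => Z j) μ := fun a => by
    have h1 := iIndepFun_curry hm hi
      (fun (j : {j : ℕ // j % L = a}) (m : Fin L) => (j : ℤ) - (m : ℤ)) (by
        rintro ⟨⟨j, hj⟩, m⟩ ⟨⟨j', hj'⟩, m'⟩ h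
        simp only at h
        have hjj : j = j' := by
          have h2 := m.2
          have h3 := m'.2
          rw [← Nat.div_add_mod j L, ← Nat.div_add_mod j' L, hj, hj'] at h ⊢
          push_cast at h
          have h4 : (L : ℤ) * ((j / L : ℕ) - (j' / L : ℕ)) = m - m' := by push_cast; linarith
          have h5 : ((j / L : ℕ) : ℤ) - (j' / L : ℕ) = 0 := by
            by_contra hne
            have h6 : (L : ℤ) ∣ m - m' := ⟨_, h4.symm⟩
            have h7 : ((m : ℤ) - m') = 0 := Int.eq_zero_of_abs_lt_dvd h6 (by rw [abs_lt]; omega)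
            rw [h7] at h4
            have : (L : ℤ) ≠ 0 := by omega
            simp_all
          have : j / L = j' / L := by omega
          rw [this]
        subst hjj
        have : m = m' := Fin.ext (by omega)
        simp [this])
    -- The block lists the value at time `j - m` in position `m`, so the relative time `l ≤ 0` reads
    -- position `-l`. The values given outside `[-k, 0]` are arbitrary, since `F` ignores them.
    let extend : (Fin L → ℝ) → ℤ → ℝ := fun y l => if hl : (-l).toNat < L then y ⟨(-l).toNat, hl⟩ else 0
    have hext : Measurable extend := by
      refine measurable_pi_lambda _ fun l => ?_
      simp only [extend]
      split_ifs <;> fun_prop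
    have h2 := h1.comp (fun j y => q j * (F (extend y) - ∫ ω, F (fun l => ξ (l + (j : ℕ)) ω) ∂μ))
      (fun j => by fun_prop)
    refine h2.congr fun j => ae_of_all _ fun ω => ?_
    simp only [Function.comp, Z]
    congr 2
    refine hdep fun l hl => ?_
    have hl1 : (-l).toNat < L := by simp only [mem_Icc] at hl; omega
    simp only [extend, dif_pos hl1]
    congr 1
    simp only [mem_Icc] at hl
    omega
  have hsum : ∀ a, HasSubgaussianMGF (fun ω => ∑ j ∈ J with j % L = a, Z j ω) (Real.toNNReal V) μ := by
    intro a
    have h1 := HasSubgaussianMGF.sum_of_iIndepFun (hclass a)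
      (s := J.subtype (fun j => j % L = a)) (fun j _ => hsub j)
    have h2 : (fun ω => ∑ j ∈ J with j % L = a, Z j ω) =
        fun ω => ∑ j ∈ J.subtype (fun j => j % L = a), Z j ω := by
      funext ω
      rw [Finset.sum_subtype_eq_sum_filter (f := fun j => Z j ω)]
    rw [h2]
    refine hasSubgaussianMGF_mono h1 ?_
    rw [Real.le_toNNReal_iff_coe_le hV0, NNReal.coe_sum]
    simp only [fun j => Real.coe_toNNReal (q j ^ 2 * b ^ 2) (by positivity)]
    rw [Finset.sum_subtype_eq_sum_filter (f := fun j => q j ^ 2 * b ^ 2)]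
    refine (Finset.sum_le_sum_of_subset_of_nonneg (Finset.filter_subset _ _)
      fun j _ _ => by positivity).trans hV
  have hLpos : (0 : ℝ) < L := by rw [hL]; positivity
  have htL : 0 ≤ t / L := by positivity
  -- If all `L` class sums were below `t / L` in absolute value, the total would be below `t`. Two
  -- signs and `L` classes give the prefactor `2 (k + 1)`.
  have hcover : {ω | t ≤ |∑ j ∈ J, Z j ω|} ⊆ ⋃ a ∈ Finset.range L,
      ({ω | t / L ≤ ∑ j ∈ J with j % L = a, Z j ω} ∪
        {ω | t / L ≤ (-fun ω => ∑ j ∈ J with j % L = a, Z j ω) ω}) := by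
    intro ω hω
    simp only [mem_ofPred_eq] at hω
    by_contra hcon
    simp only [mem_iUnion, Finset.mem_range, mem_union, mem_ofPred_eq, Pi.neg_apply, not_exists,
      not_or, not_le] at hcon
    have h1 : ∑ j ∈ J, Z j ω = ∑ a ∈ Finset.range L, ∑ j ∈ J with j % L = a, Z j ω :=
      (Finset.sum_fiberwise_of_maps_to
        (fun j _ => Finset.mem_range.2 (Nat.mod_lt _ (by omega))) _).symm
    have h2 : |∑ j ∈ J, Z j ω| < ∑ a ∈ Finset.range L, t / L := by
      rw [h1]
      refine (Finset.abs_sum_le_sum_abs _ _).trans_lt ?_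
      refine Finset.sum_lt_sum_of_nonempty ⟨0, by simp [hL]⟩ fun a ha => ?_
      have := hcon a (Finset.mem_range.1 ha)
      exact abs_lt.2 ⟨by linarith, this.1⟩
    rw [Finset.sum_const, Finset.card_range, nsmul_eq_mul, mul_div_cancel₀ _ hLpos.ne'] at h2
    linarith
  refine (measureReal_mono hcover (measure_ne_top _ _)).trans ?_
  refine (measureReal_biUnion_finset_le _ _).trans ?_
  have hone : ∀ a ∈ Finset.range L, μ.real
      ({ω | t / L ≤ ∑ j ∈ J with j % L = a, Z j ω} ∪
        {ω | t / L ≤ (-fun ω => ∑ j ∈ J with j % L = a, Z j ω) ω}) ≤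
      2 * Real.exp (-(t / L) ^ 2 / (2 * V)) := fun a _ => by
    refine (measureReal_union_le _ _).trans ?_
    have h1 := (hsum a).measure_ge_le htL
    have h2 := (hsum a).neg.measure_ge_le htL
    rw [Real.coe_toNNReal V hV0] at h1 h2
    rw [two_mul (Real.exp _)]
    exact add_le_add h1 h2
  refine (Finset.sum_le_sum hone).trans (le_of_eq ?_)
  rw [Finset.sum_const, Finset.card_range, nsmul_eq_mul, hL]
  push_cast
  ring

/-! ### Riemann sums and kernel weights -/

/-- Choosing for each `n` a point that violates the bound whenever one exists turns a failure of
uniformity into a sequence along which convergence fails. -/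
theorem eventually_forall_of_seq {U : Set ℝ} {F : ℕ → ℝ → ℝ} {l : ℝ}
    (hF : ∀ u : ℕ → ℝ, (∀ n, u n ∈ U) → Tendsto (fun n => F n (u n)) atTop (𝓝 l))
    {ε : ℝ} (hε : 0 < ε) : ∀ᶠ n in atTop, ∀ u ∈ U, |F n u - l| < ε := by
  classical
  rcases U.eq_empty_or_nonempty with rfl | ⟨u₀, hu₀⟩
  · simp
  have h1 : ∀ n, ∃ v ∈ U, (∃ u ∈ U, ε ≤ |F n u - l|) → ε ≤ |F n v - l| := fun n => by
    by_cases h : ∃ u ∈ U, ε ≤ |F n u - l|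
    · obtain ⟨u, hu, hle⟩ := h
      exact ⟨u, hu, fun _ => hle⟩
    · exact ⟨u₀, hu₀, fun h' => absurd h' h⟩
  choose v hv hbad using h1
  have h2 := (Metric.tendsto_nhds.1 (hF v hv)) ε hε
  filter_upwards [h2] with n hn u hu
  by_contra! hcon
  exact absurd (hbad n ⟨u, hu, hcon⟩) (not_le.2 (by simpa [Real.dist_eq] using hn))

/-- Convergence of Riemann sums with mesh `1 / N n` and origin `v n`. -/
theorem tendsto_riemannSum {φ : ℕ → ℤ → ℝ} {ψ : ℝ → ℝ} {v N : ℕ → ℝ} {C c : ℝ}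
    (hN : Tendsto N atTop atTop) (hC : ∀ n j, |φ n j| ≤ C)
    (hsupp : ∀ᶠ n in atTop, ∀ j : ℤ, c * N n ≤ |j - v n| → φ n j = 0)
    (hwin : ∀ᶠ n : ℕ in atTop, c * N n + 1 < v n ∧ v n + c * N n < n)
    (hlim : ∀ᵐ x, Tendsto (fun n => φ n ⌊v n + N n * x⌋) atTop (𝓝 (ψ x))) :
    Tendsto (fun n => 1 / N n * ∑ j ∈ Finset.Icc 1 n, φ n j) atTop (𝓝 (∫ x, ψ x)) := by
  have hN1 : ∀ᶠ n in atTop, 1 ≤ N n := hN.eventually_ge_atTop 1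
  have hmeas : ∀ n, Measurable fun x : ℝ => φ n ⌊v n + N n * x⌋ := fun n =>
    (measurable_from_top (f := φ n)).comp (Int.measurable_floor.comp (by fun_prop))
  have hbdint : Integrable (indicator (Icc (-(c + 1)) (c + 1)) fun _ : ℝ => C) :=
    (integrable_indicator_iff measurableSet_Icc).2 (by simp)
  have hbd : ∀ᶠ n in atTop, ∀ x, ‖φ n ⌊v n + N n * x⌋‖ ≤
      indicator (Icc (-(c + 1)) (c + 1)) (fun _ : ℝ => C) x := by
    filter_upwards [hsupp, hN1] with n hs h1 x
    by_cases hx : x ∈ Icc (-(c + 1)) (c + 1)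
    · rw [indicator_of_mem hx]; exact hC _ _
    · rw [indicator_of_notMem hx, hs, norm_zero]
      have h3 := Int.floor_le (v n + N n * x)
      have h4 := Int.lt_floor_add_one (v n + N n * x)
      rw [mem_Icc, not_and_or, not_le, not_le] at hx
      rcases hx with hx | hx
      · rw [le_abs]; right; nlinarith
      · rw [le_abs]; left; nlinarith
  -- The sum is exactly the integral of a step function taking the value `φ n j` on an interval of
  -- length `1 / N n`; `hwin` keeps its support among `1 ≤ j ≤ n`. Dominated convergence then
  -- applies with no regularity of `φ` beyond the almost everywhere limit.
  have key : ∀ᶠ n in atTop, ∫ x, φ n ⌊v n + N n * x⌋ =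
      1 / N n * ∑ j ∈ Finset.Icc 1 n, φ n j := by
    filter_upwards [hsupp, hwin, hN1, hbd] with n hs hw h1 hb
    have hNpos : 0 < N n := by linarith
    have hint : Integrable fun x => φ n ⌊v n + N n * x⌋ :=
      hbdint.mono' (hmeas n).aestronglyMeasurable (ae_of_all _ hb)
    have hsub : Function.support (fun x => φ n ⌊v n + N n * x⌋) ⊆
        Ioc ((((0 : ℕ) : ℝ) + 1 - v n) / N n) (((n : ℝ) + 1 - v n) / N n) := by
      intro x hx
      have hlt : |(⌊v n + N n * x⌋ : ℝ) - v n| < c * N n := by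
        by_contra! hcon
        exact hx (hs _ hcon)
      have h3 := Int.floor_le (v n + N n * x)
      have h4 := Int.lt_floor_add_one (v n + N n * x)
      rw [abs_lt] at hlt
      constructor
      · rw [div_lt_iff₀ hNpos]; push_cast; linarith
      · rw [le_div_iff₀ hNpos]; linarith
    rw [← intervalIntegral.integral_eq_integral_of_support_subset hsub,
      ← intervalIntegral.sum_integral_adjacent_intervals
        (a := fun k : ℕ => ((k : ℝ) + 1 - v n) / N n) fun k _ => hint.intervalIntegrable]
    have hpiece : ∀ k : ℕ, ∫ x in (((k : ℝ) + 1 - v n) / N n)..((((k + 1 : ℕ) : ℝ) + 1 - v n) / N n),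
        φ n ⌊v n + N n * x⌋ = 1 / N n * φ n ((k + 1 : ℕ) : ℤ) := fun k => by
      have hle : ((k : ℝ) + 1 - v n) / N n ≤ (((k + 1 : ℕ) : ℝ) + 1 - v n) / N n := by
        gcongr; simp
      rw [intervalIntegral.integral_congr_Ioo_of_le hle
        (g := fun _ => φ n ((k + 1 : ℕ) : ℤ)), intervalIntegral.integral_const, smul_eq_mul]
      · congr 1
        push_cast
        field_simp
        ring
      · intro x hx
        have hx1 := (div_lt_iff₀ hNpos).1 hx.1
        have hx2 := (lt_div_iff₀ hNpos).1 hx.2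
        push_cast at hx2
        have : ⌊v n + N n * x⌋ = ((k + 1 : ℕ) : ℤ) := by
          rw [Int.floor_eq_iff]
          push_cast
          constructor <;> linarith
        simp only [this]
    rw [Finset.sum_congr rfl fun k _ => hpiece k, ← Finset.mul_sum]
    congr 1
    rw [Finset.range_eq_Ico, Finset.sum_Ico_add' (fun j : ℕ => φ n (j : ℤ)) 0 n 1]
    rfl
  refine Tendsto.congr' key ?_
  exact tendsto_integral_filter_of_dominated_convergence _
    (Eventually.of_forall fun n => (hmeas n).aestronglyMeasurable)
    (hbd.mono fun n hn => ae_of_all _ hn) hbdint hlim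

/-- The floor is taken around `v` and the argument centred at `w`, so that the same limit serves
kernel weights centred at `n u` and at `⌊n u⌋`. -/
theorem tendsto_floor_sub_div {v w N : ℕ → ℝ} (hN : Tendsto N atTop atTop)
    (hw : ∀ n, |v n - w n| ≤ 1) (x : ℝ) :
    Tendsto (fun n => ((⌊v n + N n * x⌋ : ℝ) - w n) / N n) atTop (𝓝 x) := by
  have h1 : Tendsto (fun n => 2 / N n) atTop (𝓝 0) := hN.const_div_atTop 2
  rw [tendsto_iff_dist_tendsto_zero]
  refine squeeze_zero' (Eventually.of_forall fun n => dist_nonneg) ?_ h1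
  filter_upwards [hN.eventually_gt_atTop 0] with n hn
  have h3 := Int.floor_le (v n + N n * x)
  have h4 := Int.lt_floor_add_one (v n + N n * x)
  have h5 := abs_le.1 (hw n)
  rw [Real.dist_eq, show ((⌊v n + N n * x⌋ : ℝ) - w n) / N n - x =
    ((⌊v n + N n * x⌋ : ℝ) - w n - N n * x) / N n by field_simp, abs_div, abs_of_pos hn]
  gcongr
  rw [abs_le]
  constructor <;> linarith

/-- The normalised kernel weight of time `j` around the time `v` with effective sample size `N`. -/
noncomputable def kernelWeight (K : ℝ → ℝ) (N v : ℝ) (j : ℕ) : ℝ := 1 / N * K ((j - v) / N)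

section KernelSums

variable {K : ℝ → ℝ} (hK : IsLocalizingKernel K) {h : ℕ → ℝ} (hh_lim : Tendsto h atTop (𝓝 0))
  (hN : Tendsto (fun n : ℕ => (n : ℝ) * h n) atTop atTop) {ε : ℝ} (hε : 0 < ε)

include hh_lim hε in
theorem eventually_window (c : ℝ) (u : ℕ → ℝ) (hu : ∀ n, u n ∈ Icc ε (1 - ε)) :
    ∀ᶠ n : ℕ in atTop, c * (n * h n) + 1 < n * u n ∧ n * u n + c * (n * h n) < n := by
  have h1 : ∀ᶠ n in atTop, |c * h n| < ε / 2 := by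
    have : Tendsto (fun n => |c * h n|) atTop (𝓝 0) := by
      simpa using (hh_lim.const_mul c).abs
    exact this.eventually_lt_const (by positivity)
  have h2 : ∀ᶠ n : ℕ in atTop, 2 / ε < n :=
    tendsto_natCast_atTop_atTop.eventually_gt_atTop _
  filter_upwards [h1, h2] with n hn1 hn2
  have hn0 : (0 : ℝ) < n := lt_trans (by positivity) hn2
  rw [div_lt_iff₀ hε] at hn2
  rw [abs_lt] at hn1
  obtain ⟨hu1, hu2⟩ := hu n
  constructor <;> nlinarith

include hK in
theorem ae_continuousAt : ∀ᵐ x, ContinuousAt K x := by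
  obtain ⟨S, hS⟩ := hK.piecewise_differentiable
  have : ∀ᵐ x : ℝ, x ∉ (S : Set ℝ) := S.countable_toSet.ae_notMem volume
  filter_upwards [this] with x hx using (hS x (by simpa using hx)).continuousAt

include hK hh_lim hN hε in
-- These sums are Riemann sums of `K`, whose integral is `1`.
theorem eventually_abs_sum_kernelWeight_sub_one {U : Set ℝ} (hU : U ⊆ Icc ε (1 - ε))
    {τ : ℝ} (hτ : 0 < τ) :
    ∀ᶠ n : ℕ in atTop, ∀ u ∈ U,
      |∑ j ∈ Finset.Icc 1 n, kernelWeight K (n * h n) (n * u) j - 1| < τ := by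
  obtain ⟨c, hc, hsupp⟩ := hK.compact_support
  obtain ⟨C, hC⟩ := hK.bounded
  refine eventually_forall_of_seq (fun u hu => ?_) hτ
  rw [← hK.integral_eq_one]
  simp only [kernelWeight, ← Finset.mul_sum]
  refine tendsto_riemannSum (φ := fun n j => K ((j - n * u n) / (n * h n))) (c := c)
    (v := fun n => n * u n) (C := C) hN
    (fun n j => hC _) ?_ (eventually_window hh_lim hε c u fun n => hU (hu n)) ?_
  · filter_upwards [hN.eventually_gt_atTop 0] with n hn j hj
    refine hsupp _ ?_
    rwa [abs_div, abs_of_pos hn, le_div_iff₀ hn]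
  · filter_upwards [ae_continuousAt hK] with x hx
    exact hx.tendsto.comp (tendsto_floor_sub_div hN (by simp) x)

include hK hh_lim hN hε in
-- This pays for moving the centre to the integer grid. `K` may jump, so no pointwise modulus of
-- continuity is available; instead both kernel values tend to `K x` at almost every `x`, and the
-- Riemann sum of their difference tends to `0`.
theorem eventually_sum_abs_kernelWeight_sub {U : Set ℝ} (hU : U ⊆ Icc ε (1 - ε))
    {τ : ℝ} (hτ : 0 < τ) :
    ∀ᶠ n : ℕ in atTop, ∀ u ∈ U,
      ∑ j ∈ Finset.Icc 1 n, |kernelWeight K (n * h n) (n * u) j -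
        kernelWeight K (n * h n) (⌊n * u⌋ : ℤ) j| < τ := by
  obtain ⟨c, hc, hsupp⟩ := hK.compact_support
  obtain ⟨C, hC⟩ := hK.bounded
  have main : ∀ᶠ n : ℕ in atTop, ∀ u ∈ U,
      |1 / (n * h n) * ∑ j ∈ Finset.Icc 1 n, |K ((j - n * u) / (n * h n)) -
        K ((j - (⌊n * u⌋ : ℤ)) / (n * h n))| - 0| < τ := by
    refine eventually_forall_of_seq (fun u hu => ?_) hτ
    have hfl : ∀ n : ℕ, |n * u n - (⌊n * u n⌋ : ℤ)| ≤ 1 := fun n => by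
      have h3 := Int.floor_le ((n : ℝ) * u n)
      have h4 := Int.lt_floor_add_one ((n : ℝ) * u n)
      rw [abs_le]; constructor <;> linarith
    rw [show (0 : ℝ) = ∫ x : ℝ, (0 : ℝ) by simp]
    -- The radius `c + 1` absorbs the shift of the centre, which is at most `1 ≤ n h`.
    refine tendsto_riemannSum (φ := fun n j => |K ((j - n * u n) / (n * h n)) -
        K ((j - (⌊n * u n⌋ : ℤ)) / (n * h n))|) (c := c + 1)
      (v := fun n => n * u n) (C := C + C) hN (fun n j => ?_) ?_
      (eventually_window hh_lim hε _ u fun n => hU (hu n)) ?_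
    · rw [abs_abs]
      exact (abs_sub _ _).trans (add_le_add (hC _) (hC _))
    · filter_upwards [hN.eventually_ge_atTop 1] with n hn j hj
      have hn0 : 0 < (n : ℝ) * h n := by linarith
      rw [hsupp, hsupp, sub_zero, abs_zero]
      · rw [abs_div, abs_of_pos hn0, le_div_iff₀ hn0]
        have := abs_sub_le (j : ℝ) (⌊n * u n⌋ : ℤ) (n * u n)
        rw [abs_sub_comm ((⌊n * u n⌋ : ℤ) : ℝ)] at this
        linarith [hfl n]
      · rw [abs_div, abs_of_pos hn0, le_div_iff₀ hn0]
        linarith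
    · filter_upwards [ae_continuousAt hK] with x hx
      have h1 := hx.tendsto.comp (tendsto_floor_sub_div hN (v := fun n : ℕ => n * u n)
        (w := fun n => n * u n) (by simp) x)
      have h2 := hx.tendsto.comp (tendsto_floor_sub_div hN (v := fun n : ℕ => n * u n)
        (w := fun n => (⌊n * u n⌋ : ℤ)) hfl x)
      have h3 := (h1.sub h2).abs
      rw [sub_self, abs_zero] at h3
      exact h3
  filter_upwards [main, hN.eventually_gt_atTop 0] with n hn hn0 u hu
  have := hn u hu
  rw [sub_zero] at this
  refine lt_of_eq_of_lt ?_ ((le_abs_self _).trans_lt this)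
  rw [Finset.mul_sum]
  refine Finset.sum_congr rfl fun j _ => ?_
  have hpos : 0 < 1 / ((n : ℝ) * h n) := by positivity
  rw [kernelWeight, kernelWeight, ← mul_sub, abs_mul, abs_of_pos hpos]

end KernelSums

/-! ### Identifiability: strict minimality at the true coefficient -/

section Gap

variable {Ω : Type*} [MeasurableSpace Ω] {μ : Measure Ω} [IsProbabilityMeasure μ]

/-- Integrate the pointwise inequality `|Y| + m ≤ |Y - m| + m 1{Y > 0} + m 1{Y ≥ m/2}`, checked
separately on `Y ≤ 0`, `0 < Y < m/2` and `Y ≥ m/2`. The two probabilities add up to less than `1`.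
-/
theorem integral_abs_lt_integral_abs_sub {Y : Ω → ℝ} (hYm : Measurable Y) (hY : Integrable Y μ)
    {m : ℝ} (hm : 0 < m) (h1 : μ {ω | 0 < Y ω} ≤ 1 / 2) (h2 : μ {ω | m / 2 ≤ Y ω} < 1 / 2) :
    ∫ ω, |Y ω| ∂μ < ∫ ω, |Y ω - m| ∂μ := by
  have hs1 : MeasurableSet {ω | 0 < Y ω} := measurableSet_lt measurable_const hYm
  have hs2 : MeasurableSet {ω | m / 2 ≤ Y ω} := measurableSet_le measurable_const hYm
  have hhalf : (1 / 2 : ENNReal).toReal = 1 / 2 := by simp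
  have h1' : μ.real {ω | 0 < Y ω} ≤ 1 / 2 := by
    rw [← hhalf]; exact ENNReal.toReal_mono (by simp) h1
  have h2' : μ.real {ω | m / 2 ≤ Y ω} < 1 / 2 := by
    rw [← hhalf]; exact (ENNReal.toReal_lt_toReal (measure_ne_top _ _) (by simp)).2 h2
  have hi1 : Integrable (indicator {ω | 0 < Y ω} fun _ => m) μ :=
    (integrable_const m).indicator hs1
  have hi2 : Integrable (indicator {ω | m / 2 ≤ Y ω} fun _ => m) μ :=
    (integrable_const m).indicator hs2
  have hi3 : Integrable (fun ω => |Y ω - m|) μ := (hY.sub (integrable_const m)).abs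
  have hle : ∫ ω, (|Y ω| + m) ∂μ ≤ ∫ ω, (|Y ω - m| +
      (indicator {ω | 0 < Y ω} (fun _ => m) ω + indicator {ω | m / 2 ≤ Y ω} (fun _ => m) ω)) ∂μ := by
    refine integral_mono (hY.abs.add (integrable_const m)) (hi3.add (hi1.add hi2)) fun ω => ?_
    simp only [indicator_apply, mem_ofPred_eq]
    split_ifs <;> grind
  have hi4 : Integrable (fun ω => indicator {ω | 0 < Y ω} (fun _ => m) ω +
      indicator {ω | m / 2 ≤ Y ω} (fun _ => m) ω) μ := hi1.add hi2
  rw [integral_add hY.abs (integrable_const m), integral_add hi3 hi4,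
    integral_add hi1 hi2, integral_indicator_const _ hs1, integral_indicator_const _ hs2,
    integral_const] at hle
  simp only [probReal_univ, smul_eq_mul, one_mul] at hle
  nlinarith

/-- For `b < 0`, if `P(Y ≥ -b/2)` were at least `1/2`, then `-b/2` would be a second median. The
case `b > 0` follows by reflecting `Y`. -/
theorem integral_abs_lt_integral_abs_add {Y : Ω → ℝ} (hYm : Measurable Y) (hY : Integrable Y μ)
    (hmed : ∀ m : ℝ, IsMedian μ Y m ↔ m = 0) {b : ℝ} (hb : b ≠ 0) :
    ∫ ω, |Y ω| ∂μ < ∫ ω, |Y ω + b| ∂μ := by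
  obtain ⟨h0, h0'⟩ := (hmed 0).2 rfl
  have hcompl : ∀ s : Set Ω, MeasurableSet s → 1 / 2 ≤ μ s → μ sᶜ ≤ 1 / 2 := fun s hs h => by
    rw [prob_compl_eq_one_sub hs, tsub_le_iff_right]
    calc (1 : ENNReal) = 1 / 2 + 1 / 2 := (ENNReal.add_halves 1).symm
      _ ≤ _ := by gcongr
  rcases lt_or_gt_of_ne hb with hb | hb
  · have h1 := integral_abs_lt_integral_abs_sub hYm hY (m := -b) (by linarith) ?_ ?_
    · simpa using h1
    · convert hcompl _ (measurableSet_le hYm measurable_const) h0 using 2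
      ext ω; simp
    · by_contra! hcon
      have := (hmed (-b / 2)).1 ⟨h0.trans (measure_mono fun ω hω => ?_), hcon⟩
      · linarith
      · simp only [mem_ofPred_eq] at hω ⊢; linarith
  · have h1 := integral_abs_lt_integral_abs_sub (Y := fun ω => -Y ω) hYm.neg hY.neg hb ?_ ?_
    · have h2 : ∀ ω, |-Y ω - b| = |Y ω + b| := fun ω => by rw [← abs_neg]; congr 1; ring
      simpa only [h2, abs_neg] using h1
    · convert hcompl _ (measurableSet_le measurable_const hYm) h0' using 2
      ext ω; simp
    · by_contra! hcon
      have := (hmed (-b / 2)).1 ⟨hcon.trans (measure_mono fun ω hω => ?_),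
        h0'.trans (measure_mono fun ω hω => ?_)⟩
      · linarith
      · simp only [mem_ofPred_eq] at hω ⊢; linarith
      · simp only [mem_ofPred_eq] at hω ⊢; linarith

/-- Linear growth of `b ↦ E|Y + b|` away from the unique median `0`. -/
theorem exists_linear_growth {Y : Ω → ℝ} (hYm : Measurable Y) (hY : Integrable Y μ)
    (hmed : ∀ m : ℝ, IsMedian μ Y m ↔ m = 0) {s : ℝ} (hs : 0 < s) :
    ∃ d : ℝ, 0 < d ∧ ∀ b : ℝ, ∫ ω, |Y ω| ∂μ + d * (|b| - s) ≤ ∫ ω, |Y ω + b| ∂μ := by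
  set G : ℝ → ℝ := fun b => ∫ ω, |Y ω + b| ∂μ with hG
  set G₀ := ∫ ω, |Y ω| ∂μ with hG₀
  have hlt : ∀ b, b ≠ 0 → G₀ < G b := fun b hb => integral_abs_lt_integral_abs_add hYm hY hmed hb
  have hint : ∀ b, Integrable (fun ω => |Y ω + b|) μ := fun b => (hY.add (integrable_const b)).abs
  set D := min (G s) (G (-s)) - G₀ with hDdef
  have hD : 0 < D := by
    rw [hDdef, sub_pos]
    exact lt_min (hlt s hs.ne') (hlt (-s) (by linarith))
  refine ⟨D / s, by positivity, fun b => ?_⟩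
  rcases le_or_gt |b| s with hb | hb
  · have h1 : D / s * (|b| - s) ≤ 0 := mul_nonpos_of_nonneg_of_nonpos (by positivity) (by linarith)
    have h2 : G₀ ≤ G b := by
      rcases eq_or_ne b 0 with rfl | hb0
      · simp [hG, hG₀]
      · exact (hlt b hb0).le
    linarith
  · have hbpos : 0 < |b| := hs.trans hb
    set t := s / |b| with ht
    have ht0 : 0 < t := by positivity
    have ht1 : t ≤ 1 := by rw [ht, div_le_one hbpos]; exact hb.le
    -- Beyond `±s` the growth comes from convexity: `t * b = ±s` lies between `0` and `b`, so the
    -- slope from `0` to `b` is at least `D / s`.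
    have hconv : G (t * b) ≤ (1 - t) * G₀ + t * G b := by
      rw [hG, hG₀]
      simp only
      rw [← integral_const_mul, ← integral_const_mul,
        ← integral_add (hY.abs.const_mul _) ((hint b).const_mul _)]
      refine integral_mono (hint _) ((hY.abs.const_mul _).add ((hint b).const_mul _)) fun ω => ?_
      calc |Y ω + t * b| = |(1 - t) * Y ω + t * (Y ω + b)| := by congr 1; ring
        _ ≤ |(1 - t) * Y ω| + |t * (Y ω + b)| := abs_add_le _ _
        _ = _ := by rw [abs_mul, abs_mul, abs_of_pos ht0, abs_of_nonneg (sub_nonneg.2 ht1)]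
    have hmin : D + G₀ ≤ G (t * b) := by
      have : t * b = s ∨ t * b = -s := by
        rcases abs_choice b with h | h
        · left; rw [ht, h]; rw [h] at hbpos; field_simp
        · right; rw [ht, h]; have : b ≠ 0 := abs_pos.1 hbpos
          field_simp
      rcases this with h | h <;> rw [h, hDdef]
      · linarith [min_le_left (G s) (G (-s))]
      · linarith [min_le_right (G s) (G (-s))]
    have h3 : D / t ≤ G b - G₀ := by rw [div_le_iff₀ ht0]; linarith
    have h4 : D / t = D / s * |b| := by rw [ht]; field_simp
    have h5 : 0 < D / s * s := by positivity
    change G₀ + D / s * (|b| - s) ≤ G b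
    rw [mul_sub]
    linarith

/-- Fubini: conditionally on `Y = y` the right-hand integrand has mean `E|X + y|`, which `φ y`
bounds from below. -/
theorem integral_le_integral_abs_add {X Y : Ω → ℝ} (hXm : Measurable X) (hYm : Measurable Y)
    (hX : Integrable X μ) (hY : Integrable Y μ) (hXY : IndepFun X Y μ) {φ : ℝ → ℝ}
    (hφm : Measurable φ) (hφ : ∀ y, φ y ≤ ∫ ω, |X ω + y| ∂μ)
    (hφi : Integrable (fun ω => φ (Y ω)) μ) :
    ∫ ω, φ (Y ω) ∂μ ≤ ∫ ω, |X ω + Y ω| ∂μ := by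
  have hmap := (indepFun_iff_map_prod_eq_prod_map_map hXm.aemeasurable hYm.aemeasurable).1 hXY
  have := Measure.isProbabilityMeasure_map (μ := μ) hXm.aemeasurable
  have := Measure.isProbabilityMeasure_map (μ := μ) hYm.aemeasurable
  have hint : Integrable (fun p : ℝ × ℝ => |p.1 + p.2|) ((μ.map X).prod (μ.map Y)) := by
    rw [← hmap, integrable_map_measure (by fun_prop) (by fun_prop)]
    exact (hX.add hY).abs
  have h1 : ∫ ω, |X ω + Y ω| ∂μ = ∫ y, ∫ x, |x + y| ∂(μ.map X) ∂(μ.map Y) := by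
    rw [← integral_prod_symm _ hint, ← hmap, integral_map (by fun_prop) (by fun_prop)]
  rw [h1, ← integral_map (f := φ) hYm.aemeasurable (by fun_prop)]
  refine integral_mono ?_ hint.integral_prod_right fun y => ?_
  · rw [integrable_map_measure (by fun_prop) (by fun_prop)]
    exact hφi
  · simp only
    rw [integral_map hXm.aemeasurable (by fun_prop)]
    exact hφ y

variable {ξ : ℤ → Ω → ℝ}

theorem measurable_movAvg (a : ℝ) (k : ℕ) (t : ℤ) : Measurable fun e : ℤ → ℝ => movAvg a e k t := by
  unfold movAvg; fun_prop

theorem measurable_frozenContrast (a₀ a : ℝ) (k : ℕ) (j : ℤ) :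
    Measurable fun e : ℤ → ℝ => frozenContrast a₀ a k e j := by
  have := measurable_movAvg a₀ k (j - 1)
  unfold frozenContrast
  exact Measurable.abs (by fun_prop)

omit [IsProbabilityMeasure μ] in
theorem indepFun_movAvg (hm : ∀ t, Measurable (ξ t)) (hi : iIndepFun ξ μ) (a : ℝ) (k : ℕ) (t : ℤ) :
    IndepFun (ξ t) (fun ω => movAvg a (fun l => ξ l ω) k (t - 1)) μ := by
  obtain ⟨T, hT⟩ : ∃ T, T = Finset.Icc (t - 1 - k) (t - 1) := ⟨_, rfl⟩
  have hdisj : Disjoint ({t} : Finset ℤ) T := by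
    rw [Finset.disjoint_singleton_left, hT, Finset.mem_Icc]; omega
  let extend : (T → ℝ) → ℤ → ℝ := fun y l => if hl : l ∈ T then y ⟨l, hl⟩ else 0
  have hext : Measurable extend := by
    refine measurable_pi_lambda _ fun l => ?_
    simp only [extend]
    split_ifs <;> fun_prop
  have hψ : Measurable fun y => movAvg a (extend y) k (t - 1) :=
    (measurable_movAvg a k (t - 1)).comp hext
  have e : (fun ω => movAvg a (fun l => ξ l ω) k (t - 1)) =
      fun ω => movAvg a (extend fun i : T => ξ i ω) k (t - 1) := by
    funext ω
    simp only [movAvg, extend]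
    refine Finset.sum_congr rfl fun i hi => ?_
    have : t - 1 - i ∈ T := by
      rw [hT, Finset.mem_Icc]; rw [Finset.mem_range] at hi; omega
    rw [dif_pos this]
  have key := IndepFun.comp (hi.indepFun_finset {t} T hdisj hm)
    (measurable_pi_apply (X := fun _ => ℝ) (⟨t, Finset.mem_singleton_self t⟩ : ({t} : Finset ℤ))) hψ
  rw [e]
  exact key

omit [IsProbabilityMeasure μ] in
theorem integrable_movAvg (hint : ∀ t, Integrable (ξ t) μ) (a : ℝ) (k : ℕ) (t : ℤ) :
    Integrable (fun ω => movAvg a (fun l => ξ l ω) k t) μ := by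
  unfold movAvg
  exact integrable_finsetSum _ fun i _ => (hint _).const_mul _

omit [IsProbabilityMeasure μ] in
theorem integrable_frozenContrast (hint : ∀ t, Integrable (ξ t) μ) (a₀ a : ℝ) (k : ℕ) (j : ℤ) :
    Integrable (fun ω => frozenContrast a₀ a k (fun l => ξ l ω) j) μ :=
  ((hint j).add ((integrable_movAvg hint a₀ k (j - 1)).const_mul _)).abs

/-- Uniform identifiability of the frozen contrast. -/
theorem exists_gap (hm : ∀ t, Measurable (ξ t)) (hi : iIndepFun ξ μ)
    (hd : ∀ t, IdentDistrib (ξ t) (ξ 0) μ μ) (hint : ∀ t, Integrable (ξ t) μ)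
    (hmed : ∀ m : ℝ, IsMedian μ (ξ 0) m ↔ m = 0) (hne : ¬ ∀ᵐ ω ∂μ, ξ 0 ω = 0)
    {η : ℝ} (hη : 0 < η) :
    ∃ γ : ℝ, 0 < γ ∧ ∀ (k : ℕ) (a₀ a : ℝ), 1 ≤ k → η ≤ |a₀ - a| →
      ∫ ω, frozenContrast a₀ a₀ k (fun l => ξ l ω) 0 ∂μ + γ ≤
        ∫ ω, frozenContrast a₀ a k (fun l => ξ l ω) 0 ∂μ := by
  set G₀ := ∫ ω, |ξ 0 ω| ∂μ with hG₀
  have hG₀pos : 0 < G₀ := by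
    rw [hG₀, integral_pos_iff_support_of_nonneg (fun _ => abs_nonneg _) (hint 0).abs,
      pos_iff_ne_zero]
    intro h0
    apply hne
    rw [ae_iff]
    convert h0 using 2
    ext ω; simp
  -- Below, `E|(a₀ - a) V| ≥ η G₀`. The threshold `η G₀ / 2` is half of this, so linear growth
  -- leaves the gap `d * (η G₀ / 2)`.
  obtain ⟨d, hd0, hdG⟩ := exists_linear_growth (hm 0) (hint 0) hmed
    (s := η * G₀ / 2) (by positivity)
  refine ⟨d * (η * G₀ / 2), by positivity, fun k a₀ a hk ha => ?_⟩
  obtain ⟨k, rfl⟩ : ∃ l, k = l + 1 := ⟨k - 1, by omega⟩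
  set V := fun ω => movAvg a₀ (fun l => ξ l ω) (k + 1) (0 - 1) with hV
  have hVm : Measurable V := (measurable_movAvg a₀ (k + 1) _).comp (measurable_pi_lambda _ hm)
  have hVi : Integrable V μ := integrable_movAvg hint _ _ _
  -- `V` is `ξ_{-1}` plus an independent term, and adding such a term cannot lower the mean absolute
  -- value. This uses `k ≥ 1` and makes the gap independent of `k` and `a₀`.
  have hEV : G₀ ≤ ∫ ω, |V ω| ∂μ := by
    have h1 := integral_le_integral_abs_add (X := ξ (-1))
      (Y := fun ω => a₀ * movAvg a₀ (fun l => ξ l ω) k (-1 - 1)) (φ := fun _ => G₀) (hm _)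
      (((measurable_movAvg a₀ k _).comp (measurable_pi_lambda _ hm)).const_mul a₀) (hint _)
      ((integrable_movAvg hint _ _ _).const_mul _)
      ((indepFun_movAvg hm hi a₀ k (-1)).comp measurable_id (measurable_const_mul a₀))
      measurable_const (fun y => by
        have h2 : ∫ ω, |ξ (-1) ω + y| ∂μ = ∫ ω, |ξ 0 ω + y| ∂μ :=
          ((hd (-1)).comp (u := fun x => |x + y|) (by fun_prop)).integral_eq
        rw [h2]
        rcases eq_or_ne y 0 with rfl | hy
        · simp [hG₀]
        · exact (integral_abs_lt_integral_abs_add (hm 0) (hint 0) hmed hy).le)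
      (integrable_const _)
    simp only [integral_const, probReal_univ, one_smul] at h1
    refine h1.trans (le_of_eq ?_)
    congr 1
    funext ω
    rw [hV]
    simp only [movAvg_succ, zero_sub]
  have h0 : ∫ ω, frozenContrast a₀ a₀ (k + 1) (fun l => ξ l ω) 0 ∂μ = G₀ := by
    simp [frozenContrast, hG₀]
  rw [h0]
  have hφi : Integrable (fun ω => G₀ + d * (|(a₀ - a) * V ω| - η * G₀ / 2)) μ :=
    (integrable_const _).add (((hVi.const_mul _).abs.sub (integrable_const _)).const_mul _)
  have h1 := integral_le_integral_abs_add (X := ξ 0) (Y := fun ω => (a₀ - a) * V ω)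
    (φ := fun y => G₀ + d * (|y| - η * G₀ / 2)) (hm 0) (hVm.const_mul _) (hint 0)
    (hVi.const_mul _) ((indepFun_movAvg hm hi a₀ (k + 1) 0).comp measurable_id
      (measurable_const_mul (a₀ - a))) (by fun_prop) hdG hφi
  refine le_trans ?_ h1
  have h2 : ∫ ω, (G₀ + d * (|(a₀ - a) * V ω| - η * G₀ / 2)) ∂μ =
      G₀ + d * (|a₀ - a| * ∫ ω, |V ω| ∂μ - η * G₀ / 2) := by
    have h3 : Integrable (fun ω => |(a₀ - a) * V ω|) μ := (hVi.const_mul _).abs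
    have h4 : Integrable (fun ω => |(a₀ - a) * V ω| - η * G₀ / 2) μ :=
      h3.sub (integrable_const _)
    rw [integral_add (integrable_const _) (h4.const_mul _), integral_const_mul,
      integral_sub h3 (integrable_const _)]
    simp only [abs_mul, integral_const_mul, integral_const, probReal_univ, one_smul]
  rw [h2]
  have h3 : η * G₀ ≤ |a₀ - a| * ∫ ω, |V ω| ∂μ := by gcongr
  gcongr
  linarith

end Gap

/-! ### Sums over kernel windows -/

/-- The sum of the geometric averages of `w` over the times `j ∈ [1, n]` with `|j - v| < M`. -/
noncomputable def windowSum (s M v : ℝ) (w : ℤ → ℝ) (n : ℕ) : ℝ :=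
  ∑ j ∈ Finset.Icc 1 n with |((j : ℕ) : ℝ) - v| < M, geomSum s w j

/-- The length of the block depends on `M` only, so a supremum over real centres `v` reduces to a
maximum over integer starting points. The truncated floor also covers windows reaching below time
`1`. -/
theorem window_subset (M v : ℝ) (n : ℕ) :
    {j ∈ Finset.Icc 1 n | |((j : ℕ) : ℝ) - v| < M} ⊆
      Finset.Ico (⌊v - M⌋₊ + 1) (⌊v - M⌋₊ + 1 + (⌈2 * M⌉₊ + 1)) := by
  intro j hj
  rw [Finset.mem_filter, Finset.mem_Icc, abs_lt] at hj
  obtain ⟨⟨h1, h2⟩, h3, h4⟩ := hj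
  rw [Finset.mem_Ico]
  have h5 := Nat.le_ceil (2 * M)
  rcases le_or_gt 0 (v - M) with h | h
  · have h6 := Nat.floor_le h
    have h7 := Nat.lt_floor_add_one (v - M)
    constructor
    · have : ((⌊v - M⌋₊ : ℕ) : ℝ) < j := by linarith
      have := Nat.cast_lt.1 this
      omega
    · have : (j : ℝ) < ((⌊v - M⌋₊ + 1 + (⌈2 * M⌉₊ + 1) : ℕ) : ℝ) := by push_cast; linarith
      exact Nat.cast_lt.1 this
  · rw [Nat.floor_of_nonpos h.le]
    refine ⟨by omega, ?_⟩
    have : (j : ℝ) < ((0 + 1 + (⌈2 * M⌉₊ + 1) : ℕ) : ℝ) := by push_cast; linarith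
    exact Nat.cast_lt.1 this

theorem card_window_le (M v : ℝ) (hM : 0 ≤ M) (n : ℕ) :
    (({j ∈ Finset.Icc 1 n | |((j : ℕ) : ℝ) - v| < M} : Finset ℕ).card : ℝ) ≤ 2 * M + 2 := by
  have h1 := Finset.card_le_card (window_subset M v n)
  rw [Nat.card_Ico, Nat.add_sub_cancel_left] at h1
  have h2 : (({j ∈ Finset.Icc 1 n | |((j : ℕ) : ℝ) - v| < M} : Finset ℕ).card : ℝ) ≤
      ⌈2 * M⌉₊ + 1 := by exact_mod_cast h1
  have h3 := Nat.ceil_lt_add_one (a := 2 * M) (by positivity)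
  linarith

theorem windowSum_mono {s : ℝ} (hs : 0 ≤ s) (M v : ℝ) {w w' : ℤ → ℝ} (hw : ∀ l, w l ≤ w' l)
    (n : ℕ) : windowSum s M v w n ≤ windowSum s M v w' n :=
  Finset.sum_le_sum fun j _ => geomSum_mono hs hw j

theorem windowSum_const_add_le {s B M : ℝ} (hs : 0 ≤ s) (hs1 : s < 1) (hB : 0 ≤ B) (hM : 0 ≤ M)
    (v : ℝ) (w : ℤ → ℝ) (n : ℕ) :
    windowSum s M v (fun l => B + w l) n ≤ (2 * M + 2) * (B / (1 - s)) + windowSum s M v w n := by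
  have h1 : 0 < 1 - s := by linarith
  refine (Finset.sum_le_sum fun j _ => geomSum_const_add_le hs hs1 hB w j).trans ?_
  rw [Finset.sum_add_distrib, Finset.sum_const, nsmul_eq_mul]
  refine add_le_add ?_ le_rfl
  have := card_window_le M v hM n
  gcongr

/-- A uniform bound for block sums of `w` gives one for the block sums of its geometric averages. -/
theorem sum_geomSum_le {s R : ℝ} (hs : 0 ≤ s) (hs1 : s < 1) {w : ℤ → ℝ} (hw : ∀ l, 0 ≤ w l)
    (m A : ℕ) (hR : ∀ a ≤ A, ∑ i ∈ Finset.range m, w ((a + i : ℕ) + 1 : ℤ) ≤ R) (a : ℕ)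
    (ha : a ≤ A) : ∑ i ∈ Finset.range m, geomSum s w (a + i + 1) ≤ R / (1 - s) := by
  have h1 : 0 < 1 - s := by linarith
  -- The block sums obey the same recursion as `geomSum`, so `R / (1 - s)` propagates from block to
  -- block. In the first block, shifting back one step can only lower the sum because `geomSum`
  -- starts at `0`.
  have hrec : ∀ a, ∑ i ∈ Finset.range m, geomSum s w (a + i + 1) =
      s * ∑ i ∈ Finset.range m, geomSum s w (a + i) +
        ∑ i ∈ Finset.range m, w ((a + i : ℕ) + 1 : ℤ) := fun a => by
    simp only [geomSum_succ, Finset.sum_add_distrib, Finset.mul_sum]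
  induction a with
  | zero =>
    have h2 : ∑ i ∈ Finset.range m, geomSum s w (0 + i) ≤
        ∑ i ∈ Finset.range m, geomSum s w (0 + i + 1) := by
      have h3 := Finset.sum_range_sub (geomSum s w) m
      rw [Finset.sum_sub_distrib] at h3
      have h4 : geomSum s w 0 = 0 := rfl
      have h5 := geomSum_nonneg hs hw m
      simp only [zero_add]
      linarith
    rw [le_div_iff₀ h1]
    have h3 := hrec 0
    have h4 := hR 0 ha
    nlinarith [mul_le_mul_of_nonneg_left h2 hs]
  | succ a ih =>
    rw [hrec]
    have h2 : ∑ i ∈ Finset.range m, geomSum s w (a + 1 + i) =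
        ∑ i ∈ Finset.range m, geomSum s w (a + i + 1) :=
      Finset.sum_congr rfl fun i _ => by rw [Nat.add_right_comm]
    rw [h2]
    have h3 := mul_le_mul_of_nonneg_left (ih (by omega)) hs
    have h4 := hR (a + 1) ha
    have h5 : s * (R / (1 - s)) + R = R / (1 - s) := by field_simp; ring
    linarith

theorem windowSum_le {s R : ℝ} (hs : 0 ≤ s) (hs1 : s < 1) {w : ℤ → ℝ} (hw : ∀ l, 0 ≤ w l)
    {M v : ℝ} (hM : 0 ≤ M) {n : ℕ} (hv : v ≤ n)
    (hR : ∀ a ≤ n, ∑ i ∈ Finset.range (⌈2 * M⌉₊ + 1), w ((a + i : ℕ) + 1 : ℤ) ≤ R) :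
    windowSum s M v w n ≤ R / (1 - s) := by
  refine le_trans ?_ (sum_geomSum_le hs hs1 hw (⌈2 * M⌉₊ + 1) n hR ⌊v - M⌋₊ ?_)
  · refine (Finset.sum_le_sum_of_subset_of_nonneg (window_subset M v n)
      fun j _ _ => geomSum_nonneg hs hw j).trans (le_of_eq ?_)
    rw [Finset.sum_Ico_eq_sum_range, Nat.add_sub_cancel_left]
    exact Finset.sum_congr rfl fun i _ => by rw [Nat.add_right_comm]
  · exact Nat.floor_le_of_le (by linarith)

/-! ### Tails at a single location -/

section Tail

variable {Ω : Type*} [MeasurableSpace Ω] {μ : Measure Ω} [IsProbabilityMeasure μ]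

omit [IsProbabilityMeasure μ] in
theorem integrable_geomSum {w : ℤ → Ω → ℝ} (hw : ∀ l, Integrable (w l) μ) (s : ℝ) (t : ℕ) :
    Integrable (fun ω => geomSum s (fun l => w l ω) t) μ := by
  induction t with
  | zero => exact integrable_zero _ _ _
  | succ t ih => exact (ih.const_mul s).add (hw _)

omit [IsProbabilityMeasure μ] in
theorem integral_geomSum_le {w : ℤ → Ω → ℝ} (hw : ∀ l, Integrable (w l) μ) {s A : ℝ}
    (hs : 0 ≤ s) (hs1 : s < 1) (hA : 0 ≤ A) (hwA : ∀ l, ∫ ω, w l ω ∂μ ≤ A) (t : ℕ) :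
    ∫ ω, geomSum s (fun l => w l ω) t ∂μ ≤ A / (1 - s) := by
  have h1 : 0 < 1 - s := by linarith
  induction t with
  | zero => simp only [geomSum, ar1Rec, integral_zero]; positivity
  | succ t ih =>
    simp only [geomSum_succ]
    rw [integral_add ((integrable_geomSum hw s t).const_mul s) (hw _), integral_const_mul]
    have h3 := mul_le_mul_of_nonneg_left ih hs
    have h5 : s * (A / (1 - s)) + A = A / (1 - s) := by field_simp; ring
    linarith [hwA ((t : ℤ) + 1)]

omit [IsProbabilityMeasure μ] in
theorem integrable_abs_sub_clip {Y : Ω → ℝ} (hYm : Measurable Y) (hY : Integrable Y μ) {B : ℝ}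
    (hB : 0 ≤ B) : Integrable (fun ω => |Y ω - clip B (Y ω)|) μ := by
  have := (continuous_clip B).measurable
  refine hY.abs.mono' (by fun_prop) (ae_of_all _ fun ω => ?_)
  rw [Real.norm_eq_abs, abs_abs]
  exact abs_sub_clip_le_abs hB _

omit [IsProbabilityMeasure μ] in
theorem exists_integral_abs_sub_clip_le {Y : Ω → ℝ} (hYm : Measurable Y) (hY : Integrable Y μ)
    {τ : ℝ} (hτ : 0 < τ) :
    ∃ B₀ : ℝ, 0 ≤ B₀ ∧ ∀ B, B₀ ≤ B → ∫ ω, |Y ω - clip B (Y ω)| ∂μ ≤ τ := by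
  have h1 : Tendsto (fun B : ℝ => ∫ ω, |Y ω - clip B (Y ω)| ∂μ) atTop (𝓝 (∫ _ω, (0 : ℝ) ∂μ)) := by
    refine tendsto_integral_filter_of_dominated_convergence (fun ω => |Y ω|)
      (Eventually.of_forall fun B => ?_) ?_ hY.abs (ae_of_all _ fun ω => ?_)
    · have := (continuous_clip B).measurable
      exact Measurable.aestronglyMeasurable (by fun_prop)
    · filter_upwards [eventually_ge_atTop 0] with B hB
      refine ae_of_all _ fun ω => ?_
      rw [Real.norm_eq_abs, abs_abs]
      exact abs_sub_clip_le_abs hB _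
    · refine tendsto_const_nhds.congr' ?_
      filter_upwards [eventually_ge_atTop |Y ω|] with B hB
      exact (abs_sub_clip_eq_zero hB).symm
  rw [integral_zero] at h1
  obtain ⟨B₁, hB₁⟩ := eventually_atTop.1 (h1.eventually_le_const hτ)
  exact ⟨max 0 B₁, le_max_left _ _, fun B hB => hB₁ B ((le_max_right _ _).trans hB)⟩

/-- Uniform negligibility over `U` of the local averages of the truncated parts of the
innovations. -/
def NegligibleTails (μ : Measure Ω) (ξ : ℤ → Ω → ℝ) (h : ℕ → ℝ) (U : Set ℝ) : Prop :=
  ∀ s c δ η : ℝ, 0 < s → s < 1 → 0 < c → 0 < δ → 0 < η → ∃ B₀ : ℝ, 0 ≤ B₀ ∧ ∀ B, B₀ ≤ B →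
    ∀ᶠ n : ℕ in atTop, μ {ω | ∃ u ∈ U, η * (n * h n) <
      windowSum s (c * (n * h n)) (n * u) (fun l => |ξ l ω - clip B (ξ l ω)|) n} ≤
        ENNReal.ofReal δ

variable {ξ : ℤ → Ω → ℝ}

omit [IsProbabilityMeasure μ] in
theorem integral_abs_sub_clip_eq (hd : ∀ t, IdentDistrib (ξ t) (ξ 0) μ μ) (B : ℝ) (l : ℤ) :
    ∫ ω, |ξ l ω - clip B (ξ l ω)| ∂μ = ∫ ω, |ξ 0 ω - clip B (ξ 0 ω)| ∂μ := by
  have := (continuous_clip B).measurable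
  exact ((hd l).comp (u := fun x => |x - clip B x|) (by fun_prop)).integral_eq

theorem negligibleTails_singleton (hm : ∀ t, Measurable (ξ t))
    (hd : ∀ t, IdentDistrib (ξ t) (ξ 0) μ μ) (hint : ∀ t, Integrable (ξ t) μ) {h : ℕ → ℝ}
    (hN : Tendsto (fun n : ℕ => (n : ℝ) * h n) atTop atTop) (u : ℝ) :
    NegligibleTails μ ξ h {u} := by
  intro s c δ η hs hs1 hc hδ hη
  have h1s : 0 < 1 - s := by linarith
  -- With at most `(2 c + 2) N` times in the window, each costing a factor `1 / (1 - s)`, this level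
  -- makes the mean of the window sum at most `δ η N`, as Markov's inequality requires.
  obtain ⟨B₀, hB₀, hB⟩ := exists_integral_abs_sub_clip_le (hm 0) (hint 0)
    (τ := δ * η * (1 - s) / (2 * c + 2)) (by positivity)
  refine ⟨B₀, hB₀, fun B hBB => ?_⟩
  filter_upwards [hN.eventually_ge_atTop 1] with n hn
  set N := (n : ℝ) * h n with hNdef
  have hB0 : 0 ≤ B := hB₀.trans hBB
  set w : ℤ → Ω → ℝ := fun l ω => |ξ l ω - clip B (ξ l ω)| with hw
  have hwi : ∀ l, Integrable (w l) μ := fun l => integrable_abs_sub_clip (hm l) (hint l) hB0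
  have hSi : Integrable (fun ω => windowSum s (c * N) (n * u) (fun l => w l ω) n) μ :=
    integrable_finsetSum _ fun j _ => integrable_geomSum hwi s j
  have hSE : ∫ ω, windowSum s (c * N) (n * u) (fun l => w l ω) n ∂μ ≤ δ * η * N := by
    unfold windowSum
    rw [integral_finsetSum _ fun j _ => integrable_geomSum hwi s j]
    refine (Finset.sum_le_sum fun j _ => integral_geomSum_le hwi hs.le hs1
      (A := δ * η * (1 - s) / (2 * c + 2)) (by positivity)
      (fun l => (integral_abs_sub_clip_eq hd B l).le.trans (hB B hBB)) j).trans ?_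
    rw [Finset.sum_const, nsmul_eq_mul]
    have h2 : (({j ∈ Finset.Icc 1 n | |((j : ℕ) : ℝ) - n * u| < c * N} : Finset ℕ).card : ℝ) ≤
        (2 * c + 2) * N :=
      (card_window_le (c * N) (n * u) (by positivity) n).trans (by nlinarith)
    calc _ ≤ (2 * c + 2) * N * (δ * η * (1 - s) / (2 * c + 2) / (1 - s)) := by gcongr
      _ = _ := by field_simp
  have hmar := mul_meas_ge_le_integral_of_nonneg (μ := μ)
    (ae_of_all _ fun ω => Finset.sum_nonneg fun j _ =>
      geomSum_nonneg hs.le (fun l => abs_nonneg (ξ l ω - clip B (ξ l ω))) j) hSi (η * N)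
  have hηN : 0 < η * N := by positivity
  refine (measure_mono (t := {ω | η * N ≤ windowSum s (c * N) (n * u) (fun l => w l ω) n})
    ?_).trans ?_
  · rintro ω ⟨v, hv, hlt⟩
    rw [mem_singleton_iff.1 hv] at hlt
    exact hlt.le
  · rw [ENNReal.le_ofReal_iff_toReal_le (measure_ne_top _ _) hδ.le]
    have : η * N * (μ {ω | η * N ≤ windowSum s (c * N) (n * u) (fun l => w l ω) n}).toReal ≤
        η * N * δ := hmar.trans (hSE.trans (by linarith))
    exact le_of_mul_le_mul_left this hηN

end Tail

/-! ### Fuk–Nagaev bound for maxima of block sums -/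

section FukNagaev

variable {Ω : Type*} [MeasurableSpace Ω] {μ : Measure Ω} [IsProbabilityMeasure μ]

/-- If `lam * w ≤ 1`, use `e^x ≤ 1 + x e^x`; otherwise `(lam w)^p ≥ 1` and the exponential is at
most `e^{lam y}`. Only moments of order `1` and `p` enter after integration. -/
theorem exp_mul_min_le {lam w y p : ℝ} (hl : 0 < lam) (hw : 0 ≤ w) (hp : 0 < p) :
    Real.exp (lam * min w y) ≤
      1 + Real.exp 1 * lam * w + Real.exp (lam * y) * lam ^ p * w ^ p := by
  have h0 : 0 ≤ Real.exp (lam * y) * lam ^ p * w ^ p := by positivity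
  rcases le_or_gt (lam * w) 1 with h | h
  · have h1 : Real.exp (lam * min w y) ≤ Real.exp (lam * w) := by
      gcongr; exact min_le_left _ _
    have h2 : Real.exp (lam * w) ≤ 1 + lam * w * Real.exp (lam * w) := by
      have := Real.add_one_le_exp (-(lam * w))
      have h3 : Real.exp (-(lam * w)) * Real.exp (lam * w) = 1 := by
        rw [← Real.exp_add]; simp
      nlinarith [Real.exp_pos (lam * w)]
    have h3 : lam * w * Real.exp (lam * w) ≤ lam * w * Real.exp 1 := by gcongr
    linarith
  · have h1 : Real.exp (lam * min w y) ≤ Real.exp (lam * y) := by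
      gcongr; exact min_le_right _ _
    have h2 : 1 ≤ lam ^ p * w ^ p := by
      rw [← Real.mul_rpow hl.le hw]
      exact Real.one_le_rpow h.le hp.le
    have h3 : 0 ≤ Real.exp 1 * lam * w := by positivity
    nlinarith [Real.exp_pos (lam * y)]

/-- Chernoff's bound, with the moment generating function of each capped variable estimated by
`exp_mul_min_le` and `1 + x ≤ e^x`. -/
theorem measure_sum_min_ge_le {ι : Type*} {Y : ι → Ω → ℝ} (hm : ∀ l, Measurable (Y l))
    (hi : iIndepFun Y μ) (h0 : ∀ l ω, 0 ≤ Y l ω) {p A M lam y : ℝ} (hp : 0 < p) (hl : 0 < lam)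
    (hint : ∀ l, Integrable (Y l) μ) (hintp : ∀ l, Integrable (fun ω => Y l ω ^ p) μ)
    (hA : ∀ l, ∫ ω, Y l ω ∂μ ≤ A) (hM : ∀ l, ∫ ω, Y l ω ^ p ∂μ ≤ M) (S : Finset ι) (R : ℝ) :
    μ.real {ω | R ≤ ∑ l ∈ S, min (Y l ω) y} ≤ Real.exp (-lam * R + S.card *
      (Real.exp 1 * lam * A + Real.exp (lam * y) * lam ^ p * M)) := by
  set Z : ι → Ω → ℝ := fun l ω => min (Y l ω) y with hZ
  have hZm : ∀ l, Measurable (Z l) := fun l => (hm l).min measurable_const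
  have hZi : iIndepFun Z μ := hi.comp (fun _ x => min x y) fun _ => by fun_prop
  have hmgf : ∀ l, mgf (Z l) μ lam ≤
      Real.exp (Real.exp 1 * lam * A + Real.exp (lam * y) * lam ^ p * M) := fun l => by
    have hi1 : Integrable (fun ω => 1 + Real.exp 1 * lam * Y l ω) μ :=
      (integrable_const _).add ((hint l).const_mul _)
    have hi2 : Integrable (fun ω => Real.exp (lam * y) * lam ^ p * Y l ω ^ p) μ :=
      (hintp l).const_mul _
    have h1 : mgf (Z l) μ lam ≤
        ∫ ω, (1 + Real.exp 1 * lam * Y l ω + Real.exp (lam * y) * lam ^ p * Y l ω ^ p) ∂μ := by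
      refine integral_mono_of_nonneg (ae_of_all _ fun ω => (Real.exp_pos _).le)
        (hi1.add hi2) (ae_of_all _ fun ω => exp_mul_min_le hl (h0 l ω) hp)
    rw [integral_add hi1 hi2, integral_add (integrable_const _) ((hint l).const_mul _),
      integral_const_mul, integral_const_mul, integral_const] at h1
    simp only [probReal_univ, one_smul] at h1
    refine h1.trans ((le_trans ?_ (Real.add_one_le_exp _)))
    have h2 : Real.exp 1 * lam * ∫ ω, Y l ω ∂μ ≤ Real.exp 1 * lam * A := by
      gcongr; exact hA l
    have h3 : Real.exp (lam * y) * lam ^ p * ∫ ω, Y l ω ^ p ∂μ ≤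
        Real.exp (lam * y) * lam ^ p * M := by
      gcongr; exact hM l
    linarith
  have hexp : Integrable (fun ω => Real.exp (lam * (∑ l ∈ S, Z l) ω)) μ := by
    have hmeas : Measurable (∑ l ∈ S, Z l) := by
      have := Finset.measurable_sum S fun l _ => hZm l
      rwa [show (fun a => ∑ i ∈ S, Z i a) = ∑ l ∈ S, Z l by ext; simp] at this
    refine Integrable.of_bound (by fun_prop) (Real.exp (lam * (S.card * y)))
      (ae_of_all _ fun ω => ?_)
    rw [Real.norm_eq_abs, abs_of_pos (Real.exp_pos _)]
    gcongr
    rw [Finset.sum_apply, ← nsmul_eq_mul]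
    exact Finset.sum_le_card_nsmul _ _ _ fun l _ => min_le_right _ _
  have h1 := measure_ge_le_exp_mul_mgf (X := ∑ l ∈ S, Z l) (μ := μ) R hl.le hexp
  rw [hZi.mgf_sum hZm S] at h1
  simp only [Finset.sum_apply, hZ] at h1
  refine h1.trans ?_
  rw [Real.exp_add, Real.exp_nat_mul]
  gcongr
  rw [← Finset.prod_const]
  exact Finset.prod_le_prod (fun l _ => mgf_nonneg) fun l _ => hmgf l

theorem measure_gt_le_of_integrable_rpow {Y : Ω → ℝ} (h0 : ∀ ω, 0 ≤ Y ω) {p y M : ℝ}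
    (hp : 0 < p) (hy : 0 < y) (hintp : Integrable (fun ω => Y ω ^ p) μ)
    (hM : ∫ ω, Y ω ^ p ∂μ ≤ M) : μ.real {ω | y < Y ω} ≤ M / y ^ p := by
  have h1 := mul_meas_ge_le_integral_of_nonneg (μ := μ) (f := fun ω => Y ω ^ p)
    (ae_of_all _ fun ω => Real.rpow_nonneg (h0 ω) p) hintp (y ^ p)
  have hyp : 0 < y ^ p := by positivity
  have h2 : μ.real {ω | y < Y ω} ≤ μ.real {ω | y ^ p ≤ Y ω ^ p} := by
    refine measureReal_mono (fun ω hω => ?_) (measure_ne_top _ _)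
    exact Real.rpow_le_rpow hy.le (le_of_lt hω) hp.le
  rw [le_div_iff₀ hyp]
  calc _ ≤ μ.real {ω | y ^ p ≤ Y ω ^ p} * y ^ p := by gcongr
    _ ≤ M := by rw [mul_comm]; exact h1.trans hM

/-- A Fuk–Nagaev type bound for the maximum of block sums of nonnegative variables. -/
theorem measure_exists_block_gt_le {Y : ℤ → Ω → ℝ} (hm : ∀ l, Measurable (Y l))
    (hi : iIndepFun Y μ) (h0 : ∀ l ω, 0 ≤ Y l ω) {p A M lam y : ℝ} (hp : 0 < p) (hl : 0 < lam)
    (hy : 0 < y) (hint : ∀ l, Integrable (Y l) μ) (hintp : ∀ l, Integrable (fun ω => Y l ω ^ p) μ)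
    (hA : ∀ l, ∫ ω, Y l ω ∂μ ≤ A) (hM : ∀ l, ∫ ω, Y l ω ^ p ∂μ ≤ M) (m n : ℕ) (R : ℝ) :
    μ.real {ω | ∃ a ≤ n, R < ∑ i ∈ Finset.range m, Y ((a + i : ℕ) + 1 : ℤ) ω} ≤
      (n + m) * (M / y ^ p) + (n + 1) * Real.exp (-lam * R + m *
      (Real.exp 1 * lam * A + Real.exp (lam * y) * lam ^ p * M)) := by
  -- Either one of the `n + m` variables involved exceeds `y`, or capping at `y` changes nothing and
  -- some capped block sum is large.
  have hcover : {ω | ∃ a ≤ n, R < ∑ i ∈ Finset.range m, Y ((a + i : ℕ) + 1 : ℤ) ω} ⊆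
      (⋃ l ∈ Finset.range (n + m), {ω | y < Y ((l : ℕ) + 1 : ℤ) ω}) ∪
      ⋃ a ∈ Finset.range (n + 1),
        {ω | R ≤ ∑ i ∈ Finset.range m, min (Y ((a + i : ℕ) + 1 : ℤ) ω) y} := by
    rintro ω ⟨a, ha, hlt⟩
    by_contra hcon
    simp only [mem_union, mem_iUnion, Finset.mem_range, mem_ofPred_eq, not_or, not_exists,
      not_lt, not_le] at hcon
    obtain ⟨h1, h2⟩ := hcon
    have h3 := h2 a (by omega)
    rw [Finset.sum_congr rfl fun i hi => min_eq_left
      (h1 (a + i) (by have := Finset.mem_range.1 hi; omega))] at h3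
    linarith
  refine (measureReal_mono hcover (measure_ne_top _ _)).trans ?_
  refine (measureReal_union_le _ _).trans (add_le_add ?_ ?_)
  · refine (measureReal_biUnion_finset_le _ _).trans ?_
    refine (Finset.sum_le_sum fun l _ =>
      measure_gt_le_of_integrable_rpow (h0 _) hp hy (hintp _) (hM _)).trans (le_of_eq ?_)
    rw [Finset.sum_const, Finset.card_range, nsmul_eq_mul]
    push_cast; ring
  · have hone : ∀ a ∈ Finset.range (n + 1),
        μ.real {ω | R ≤ ∑ i ∈ Finset.range m, min (Y ((a + i : ℕ) + 1 : ℤ) ω) y} ≤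
        Real.exp (-lam * R + m * (Real.exp 1 * lam * A + Real.exp (lam * y) * lam ^ p * M)) :=
      fun a _ => by
      have h1 := measure_sum_min_ge_le (ι := ℕ) (y := y) (Y := fun i => Y ((a + i : ℕ) + 1 : ℤ))
        (fun i => hm _) (hi.precomp (g := fun i : ℕ => ((a + i : ℕ) + 1 : ℤ)) fun i j hij => by
          simp only at hij; omega) (fun i ω => h0 _ ω) hp hl (fun i => hint _)
        (fun i => hintp _) (fun i => hA _) (fun i => hM _) (Finset.range m) R
      rwa [Finset.card_range] at h1
    refine (measureReal_biUnion_finset_le _ _).trans ((Finset.sum_le_sum hone).trans (le_of_eq ?_))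
    rw [Finset.sum_const, Finset.card_range, nsmul_eq_mul]
    push_cast; ring

end FukNagaev

/-! ### Bandwidth rates and uniform negligibility of tails -/

/-- The quotient equals `(n^{1-1/p} h)^{-p}`. It is the order of the probability bound that has to
vanish for uniform consistency. -/
theorem tendsto_div_rpow_of_tendsto {h : ℕ → ℝ} (hh_pos : ∀ n, 0 < h n) {p : ℝ} (hp : 1 < p)
    (hN : Tendsto (fun n : ℕ => (n : ℝ) ^ (1 - 1 / p) * h n) atTop atTop) :
    Tendsto (fun n : ℕ => (n : ℝ) / (n * h n) ^ p) atTop (𝓝 0) := by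
  have hp0 : 0 < p := by linarith
  have h1 := ((tendsto_rpow_atTop hp0).comp hN).inv_tendsto_atTop
  refine h1.congr' ?_
  filter_upwards [eventually_gt_atTop 0] with n hn
  have hn0 : (0 : ℝ) < n := by exact_mod_cast hn
  have hh := hh_pos n
  simp only [Function.comp, Pi.inv_apply]
  rw [Real.mul_rpow (by positivity) hh.le, Real.mul_rpow hn0.le hh.le, ← Real.rpow_mul hn0.le,
    show (1 - 1 / p) * p = p - 1 by field_simp, Real.rpow_sub hn0, Real.rpow_one]
  have : 0 < (n : ℝ) ^ p := by positivity
  have : 0 < (h n) ^ p := by positivity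
  field_simp

theorem tendsto_natCast_mul_of_tendsto_rpow {h : ℕ → ℝ} (hh_pos : ∀ n, 0 < h n) {p : ℝ}
    (hp : 1 < p) (hN : Tendsto (fun n : ℕ => (n : ℝ) ^ (1 - 1 / p) * h n) atTop atTop) :
    Tendsto (fun n : ℕ => (n : ℝ) * h n) atTop atTop := by
  refine tendsto_atTop_mono' _ ?_ hN
  filter_upwards [eventually_ge_atTop 1] with n hn
  have hn0 : (1 : ℝ) ≤ n := by exact_mod_cast hn
  have hh := hh_pos n
  have : 0 < 1 / p := by positivity
  gcongr
  calc (n : ℝ) ^ (1 - 1 / p) ≤ (n : ℝ) ^ (1 : ℝ) :=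
        Real.rpow_le_rpow_of_exponent_le hn0 (by linarith)
    _ = n := Real.rpow_one _

section Tail

variable {Ω : Type*} [MeasurableSpace Ω] {μ : Measure Ω} [IsProbabilityMeasure μ]
  {ξ : ℤ → Ω → ℝ}

theorem eventually_log_rpow_mul_le {N : ℕ → ℝ} (hN : Tendsto N atTop atTop) (D p : ℝ) {q : ℝ}
    (hq : 0 < q) : ∀ᶠ n in atTop, D * (Real.log (N n) ^ p * N n ^ (-q)) ≤ 1 := by
  have h1 := (isLittleO_log_rpow_rpow_atTop p hq).tendsto_div_nhds_zero.const_mul D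
  rw [mul_zero] at h1
  filter_upwards [(h1.comp hN).eventually_le_const one_pos, hN.eventually_gt_atTop 0] with n hn h0
  rw [Real.rpow_neg h0.le, ← div_eq_mul_inv]
  exact hn

/-- Apply the Fuk–Nagaev bound with `lam = κ log N / N` and cap `y = β N`, where `N = n h`. Both the
large-value term and the union of Chernoff bounds over block starts are then `O(n / N^p)`. -/
theorem negligibleTails_of_memLp (hm : ∀ t, Measurable (ξ t)) (hi : iIndepFun ξ μ)
    (hd : ∀ t, IdentDistrib (ξ t) (ξ 0) μ μ) (hint : ∀ t, Integrable (ξ t) μ) {h : ℕ → ℝ}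
    (hh_pos : ∀ n, 0 < h n) (hh_lim : Tendsto h atTop (𝓝 0)) {p : ℝ} (hp : 1 < p)
    (hLp : MemLp (ξ 0) (ENNReal.ofReal p) μ)
    (hN : Tendsto (fun n : ℕ => (n : ℝ) ^ (1 - 1 / p) * h n) atTop atTop) {U : Set ℝ}
    (hU : U ⊆ Icc 0 1) : NegligibleTails μ ξ h U := by
  intro s c δ η hs hs1 hc hδ hη
  have h1s : 0 < 1 - s := by linarith
  have hp0 : 0 < p := by linarith
  have hNat := tendsto_natCast_mul_of_tendsto_rpow hh_pos hp hN
  have hdiv := tendsto_div_rpow_of_tendsto hh_pos hp hN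
  set C := 2 * c + 2 with hC
  have hC0 : 0 < C := by positivity
  set η' := (1 - s) * η with hη'
  have hη'0 : 0 < η' := by positivity
  -- The choice of `κ` gives `lam * η' * N = 2 p log N`, and that of `A` bounds the first-moment
  -- term by `p log N`. As `κ β = (p - 1)/2`, one has `e^{lam y} = N^{(p-1)/2}`, so the `p`-th
  -- moment term tends to `0`. The exponent is thus at most `1 - p log N`.
  set κ := 2 * p / η' with hκ
  have hκ0 : 0 < κ := by positivity
  set β := (p - 1) / 2 / κ with hβ
  have hβ0 : 0 < β := by
    have : 0 < p - 1 := by linarith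
    positivity
  set A := η' / (2 * C * Real.exp 1) with hA
  have hA0 : 0 < A := by positivity
  obtain ⟨B₀, hB₀, hB⟩ := exists_integral_abs_sub_clip_le (hm 0) (hint 0) hA0
  refine ⟨B₀, hB₀, fun B hBB => ?_⟩
  have hB0 : 0 ≤ B := hB₀.trans hBB
  set Y : ℤ → Ω → ℝ := fun l ω => |ξ l ω - clip B (ξ l ω)| with hY
  have hclip := (continuous_clip B).measurable
  have hYm : ∀ l, Measurable (Y l) := fun l => by
    have := hm l
    exact Measurable.abs (by fun_prop)
  have hYi : iIndepFun Y μ := hi.comp (fun _ x => |x - clip B x|) fun _ => by fun_prop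
  have hYint : ∀ l, Integrable (Y l) μ := fun l => integrable_abs_sub_clip (hm l) (hint l) hB0
  have hξp : ∀ l, Integrable (fun ω => |ξ l ω| ^ p) μ := fun l => by
    have h1 := ((hd l).symm.memLp_iff.1 hLp).integrable_norm_rpow
      (by simpa using hp0) ENNReal.ofReal_ne_top
    simpa [ENNReal.toReal_ofReal hp0.le] using h1
  set M := ∫ ω, |ξ 0 ω| ^ p ∂μ with hM
  have hM0 : 0 ≤ M := integral_nonneg fun ω => by positivity
  have hYle : ∀ l ω, Y l ω ^ p ≤ |ξ l ω| ^ p := fun l ω => by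
    have := abs_sub_clip_le_abs hB0 (ξ l ω)
    simp only [Y]
    gcongr
  have hYp : ∀ l, Integrable (fun ω => Y l ω ^ p) μ := fun l => by
    refine (hξp l).mono' ((hYm l).pow_const p).aestronglyMeasurable (ae_of_all _ fun ω => ?_)
    rw [Real.norm_eq_abs, abs_of_nonneg (Real.rpow_nonneg (abs_nonneg _) _)]
    exact hYle l ω
  have hYM : ∀ l, ∫ ω, Y l ω ^ p ∂μ ≤ M := fun l => by
    refine (integral_mono (hYp l) (hξp l) (hYle l)).trans (le_of_eq ?_)
    exact ((hd l).comp (u := fun x => |x| ^ p) (by fun_prop)).integral_eq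
  have hYA : ∀ l, ∫ ω, Y l ω ∂μ ≤ A := fun l =>
    (integral_abs_sub_clip_eq hd B l).le.trans (hB B hBB)
  have hlog := eventually_log_rpow_mul_le hNat (C * κ ^ p * M) p (q := (p - 1) / 2) (by linarith)
  have hfin : ∀ᶠ n : ℕ in atTop,
      (2 * M / β ^ p + 2 * Real.exp 1) * ((n : ℝ) / (n * h n) ^ p) ≤ δ := by
    have h1 := hdiv.const_mul (2 * M / β ^ p + 2 * Real.exp 1)
    rw [mul_zero] at h1
    exact h1.eventually_le_const hδ
  -- This makes the block length `m ≤ C N` at most `n`, so that `n + m ≤ 2 n`.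
  have hCh : ∀ᶠ n in atTop, C * h n ≤ 1 := by
    have h1 := hh_lim.const_mul C
    rw [mul_zero] at h1
    exact h1.eventually_le_const one_pos
  filter_upwards [hlog, hfin, hCh, hNat.eventually_gt_atTop 1, eventually_ge_atTop 1]
    with n hn1 hn2 hn3 hn4 hn5
  set N := (n : ℝ) * h n with hNdef
  have hn0 : (1 : ℝ) ≤ n := by exact_mod_cast hn5
  have hNpos : 0 < N := by linarith
  have hlogN : 0 < Real.log N := Real.log_pos hn4
  set m := ⌈2 * (c * N)⌉₊ + 1 with hmdef
  have hmC : (m : ℝ) ≤ C * N := by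
    have h3 := Nat.ceil_lt_add_one (a := 2 * (c * N)) (by positivity)
    rw [hmdef]; push_cast
    rw [hC]; nlinarith
  have hmn : (m : ℝ) ≤ n := by
    refine hmC.trans ?_
    rw [hNdef]
    nlinarith
  set lam := κ * Real.log N / N with hlam
  have hlam0 : 0 < lam := by positivity
  have hcover : {ω | ∃ u ∈ U, η * N < windowSum s (c * N) (n * u) (fun l => Y l ω) n} ⊆
      {ω | ∃ a ≤ n, η' * N < ∑ i ∈ Finset.range m, Y ((a + i : ℕ) + 1 : ℤ) ω} := by
    rintro ω ⟨u, hu, hlt⟩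
    by_contra hcon
    simp only [mem_ofPred_eq, not_exists, not_and, not_lt] at hcon
    have h1 := windowSum_le hs.le hs1 (w := fun l => Y l ω) (fun l => abs_nonneg _)
      (M := c * N) (v := n * u) (by positivity) (n := n) (by nlinarith [(hU hu).2]) hcon
    have h2 : η' * N / (1 - s) = η * N := by rw [hη']; field_simp
    linarith
  have hbound := measure_exists_block_gt_le hYm hYi (fun l ω => abs_nonneg _) hp0 hlam0
    (y := β * N) (by positivity) hYint hYp hYA hYM m n (η' * N)
  refine (measure_mono hcover).trans ?_
  rw [ENNReal.le_ofReal_iff_toReal_le (measure_ne_top _ _) hδ.le]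
  refine hbound.trans (le_trans ?_ hn2)
  have hNp : 0 < N ^ p := by positivity
  have e1 : ((n : ℝ) + m) * (M / (β * N) ^ p) ≤ 2 * M / β ^ p * (n / N ^ p) := by
    rw [Real.mul_rpow hβ0.le hNpos.le]
    calc ((n : ℝ) + m) * (M / (β ^ p * N ^ p)) ≤ (n + n) * (M / (β ^ p * N ^ p)) := by gcongr
      _ = _ := by field_simp; ring
  have e2 : -lam * (η' * N) = -(2 * p) * Real.log N := by
    rw [hlam, hκ]; field_simp
  have e3 : (m : ℝ) * (Real.exp 1 * lam * A) ≤ p * Real.log N := by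
    calc (m : ℝ) * (Real.exp 1 * lam * A) ≤ C * N * (Real.exp 1 * lam * A) := by gcongr
      _ = p * Real.log N := by rw [hlam, hκ, hA]; field_simp
  have e4 : (m : ℝ) * (Real.exp (lam * (β * N)) * lam ^ p * M) ≤ 1 := by
    have h1 : Real.exp (lam * (β * N)) = N ^ ((p - 1) / 2) := by
      rw [Real.rpow_def_of_pos hNpos, hlam, hβ]
      congr 1
      field_simp
    have h2 : lam ^ p = κ ^ p * Real.log N ^ p * N ^ (-p) := by
      rw [hlam, Real.div_rpow (by positivity) hNpos.le, Real.mul_rpow hκ0.le hlogN.le,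
        Real.rpow_neg hNpos.le, div_eq_mul_inv]
    have h3 : N * N ^ ((p - 1) / 2) * N ^ (-p) = N ^ (-((p - 1) / 2)) := by
      nth_rw 1 [← Real.rpow_one N]
      rw [← Real.rpow_add hNpos, ← Real.rpow_add hNpos]
      congr 1; ring
    refine le_trans ?_ hn1
    rw [h1, h2, ← h3]
    calc (m : ℝ) * (N ^ ((p - 1) / 2) * (κ ^ p * Real.log N ^ p * N ^ (-p)) * M)
        ≤ C * N * (N ^ ((p - 1) / 2) * (κ ^ p * Real.log N ^ p * N ^ (-p)) * M) := by gcongr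
      _ = _ := by ring
  have e5 : Real.exp (-lam * (η' * N) + m * (Real.exp 1 * lam * A +
      Real.exp (lam * (β * N)) * lam ^ p * M)) ≤ Real.exp 1 * (N ^ p)⁻¹ := by
    have h1 : (N ^ p)⁻¹ = Real.exp (-(p * Real.log N)) := by
      rw [Real.exp_neg, Real.rpow_def_of_pos hNpos, mul_comm p]
    rw [h1, ← Real.exp_add]
    refine Real.exp_le_exp.2 ?_
    rw [mul_add]
    linarith
  have e6 : ((n : ℝ) + 1) * Real.exp (-lam * (η' * N) + m * (Real.exp 1 * lam * A +
      Real.exp (lam * (β * N)) * lam ^ p * M)) ≤ 2 * Real.exp 1 * (n / N ^ p) := by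
    calc _ ≤ ((n : ℝ) + n) * (Real.exp 1 * (N ^ p)⁻¹) := by gcongr
      _ = _ := by ring
  linarith

end Tail

/-! ### Error decomposition and kernel weight bounds -/

/-- The five terms are the approximation of `Z` by `f`, the change of weights from `q` to `q'`, the
fluctuation under `q'`, the defect of total mass, and the bias `gB - g`. The factor `2` arises
because weights are exchanged once on `f` and once back on the constant `gB`. -/
theorem abs_weighted_sum_sub_le {ι : Type*} (J : Finset ι) (q q' Z f : ι → ℝ) {b g gB : ℝ}
    (hf : ∀ j ∈ J, |f j| ≤ b) (hg : |gB| ≤ b) :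
    |∑ j ∈ J, q j * Z j - g| ≤ ∑ j ∈ J, |q j| * |Z j - f j| + b * (2 * ∑ j ∈ J, |q j - q' j|) +
      |∑ j ∈ J, q' j * (f j - gB)| + b * |∑ j ∈ J, q j - 1| + |gB - g| := by
  have hb : 0 ≤ b := (abs_nonneg _).trans hg
  have e : ∑ j ∈ J, q j * Z j - g = ∑ j ∈ J, q j * (Z j - f j) + ∑ j ∈ J, (q j - q' j) * f j +
      ∑ j ∈ J, q' j * (f j - gB) + gB * ∑ j ∈ J, (q' j - q j) + gB * (∑ j ∈ J, q j - 1) +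
      (gB - g) := by
    simp only [mul_sub, sub_mul, Finset.sum_sub_distrib, ← Finset.sum_mul]
    ring
  have h1 : |∑ j ∈ J, q j * (Z j - f j)| ≤ ∑ j ∈ J, |q j| * |Z j - f j| := by
    refine (Finset.abs_sum_le_sum_abs _ _).trans (le_of_eq ?_)
    exact Finset.sum_congr rfl fun j _ => abs_mul _ _
  have h2 : |∑ j ∈ J, (q j - q' j) * f j| ≤ b * ∑ j ∈ J, |q j - q' j| := by
    refine (Finset.abs_sum_le_sum_abs _ _).trans ?_
    rw [Finset.mul_sum]
    refine Finset.sum_le_sum fun j hj => ?_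
    rw [abs_mul, mul_comm]
    gcongr
    exact hf j hj
  have h3 : |gB * ∑ j ∈ J, (q' j - q j)| ≤ b * ∑ j ∈ J, |q j - q' j| := by
    rw [abs_mul]
    gcongr
    refine (Finset.abs_sum_le_sum_abs _ _).trans (le_of_eq ?_)
    exact Finset.sum_congr rfl fun j _ => abs_sub_comm _ _
  have h4 : |gB * (∑ j ∈ J, q j - 1)| ≤ b * |∑ j ∈ J, q j - 1| := by
    rw [abs_mul]; gcongr
  rw [e]
  refine (abs_add_le _ _).trans ?_
  have h5 := abs_add_le (∑ j ∈ J, q j * (Z j - f j) + ∑ j ∈ J, (q j - q' j) * f j +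
      ∑ j ∈ J, q' j * (f j - gB) + gB * ∑ j ∈ J, (q' j - q j)) (gB * (∑ j ∈ J, q j - 1))
  have h6 := abs_add_le (∑ j ∈ J, q j * (Z j - f j) + ∑ j ∈ J, (q j - q' j) * f j +
      ∑ j ∈ J, q' j * (f j - gB)) (gB * ∑ j ∈ J, (q' j - q j))
  have h7 := abs_add_three (∑ j ∈ J, q j * (Z j - f j)) (∑ j ∈ J, (q j - q' j) * f j)
      (∑ j ∈ J, q' j * (f j - gB))
  linarith

theorem localizedContrast_lav_tvAR1 {Ω : Type*} (K : ℝ → ℝ) {h : ℝ} {n : ℕ} (hn : 1 ≤ n)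
    (θ : ℕ → ℕ → ℝ) (ξ : ℤ → Ω → ℝ) (u τ : ℝ) (ω : Ω) :
    localizedContrast lavContrast K h n (fun t => tvAR1 θ ξ n t ω) u τ =
      ∑ j ∈ Finset.Icc 1 n, kernelWeight K (n * h) (n * u) j *
        |ar1Rec (θ n) (fun l => ξ l ω) j - τ * ar1Rec (θ n) (fun l => ξ l ω) (j - 1)| := by
  rw [localizedContrast, Finset.mul_sum]
  refine Finset.sum_congr rfl fun j hj => ?_
  have h1 : ((j : ℤ) - ((0 : ℕ) : ℤ)).toNat = j := by omega
  have h2 : ((j : ℤ) - ((1 : ℕ) : ℤ)).toNat = j - 1 := by omega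
  have hn0 : (n : ℝ) ≠ 0 := by positivity
  have h3 : ((j : ℝ) / n - u) / h = (j - n * u) / (n * h) := by
    rw [← div_div]; congr 1; field_simp
  simp only [lavContrast, tvAR1, h1, h2, kernelWeight, h3]
  ring

theorem kernelWeight_eq_zero {K : ℝ → ℝ} {c N : ℝ} (hK : ∀ x : ℝ, c ≤ |x| → K x = 0)
    (hN : 0 < N) {v : ℝ} {j : ℕ} (hj : ¬ |(j : ℝ) - v| < c * N) : kernelWeight K N v j = 0 := by
  rw [kernelWeight, hK, mul_zero]
  rw [abs_div, abs_of_pos hN, le_div_iff₀ hN]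
  exact not_lt.1 hj

theorem abs_kernelWeight_le {K : ℝ → ℝ} {C N : ℝ} (hK : ∀ x : ℝ, |K x| ≤ C) (hN : 0 < N) (v : ℝ)
    (j : ℕ) : |kernelWeight K N v j| ≤ C / N := by
  have h1 : 0 < 1 / N := by positivity
  rw [kernelWeight, abs_mul, abs_of_pos h1, div_mul_eq_mul_div, one_mul]
  gcongr
  exact hK _

/-- This is the variance proxy in Hoeffding's inequality: its order `1 / N` yields deviation
probabilities exponentially small in `N`. -/
theorem sum_sq_kernelWeight_le {K : ℝ → ℝ} {c C N : ℝ} (hc : 0 < c)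
    (hK : ∀ x : ℝ, c ≤ |x| → K x = 0) (hC : ∀ x : ℝ, |K x| ≤ C) (hN : 1 ≤ N) (v : ℝ) (n : ℕ) :
    ∑ j ∈ Finset.Icc 1 n, kernelWeight K N v j ^ 2 ≤ (2 * c + 2) * C ^ 2 / N := by
  have hN0 : 0 < N := by linarith
  have h1 : ∑ j ∈ Finset.Icc 1 n with |((j : ℕ) : ℝ) - v| < c * N, kernelWeight K N v j ^ 2 =
      ∑ j ∈ Finset.Icc 1 n, kernelWeight K N v j ^ 2 := by
    refine Finset.sum_filter_of_ne fun j _ hj => ?_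
    by_contra hcon
    exact hj (by rw [kernelWeight_eq_zero hK hN0 hcon]; simp)
  rw [← h1]
  have h2 : ∀ j ∈ {j ∈ Finset.Icc 1 n | |((j : ℕ) : ℝ) - v| < c * N},
      kernelWeight K N v j ^ 2 ≤ (C / N) ^ 2 := fun j _ => by
    rw [← sq_abs]
    gcongr
    exact abs_kernelWeight_le hC hN0 v j
  refine (Finset.sum_le_card_nsmul _ _ _ h2).trans ?_
  rw [nsmul_eq_mul]
  have h3 : (({j ∈ Finset.Icc 1 n | |((j : ℕ) : ℝ) - v| < c * N} : Finset ℕ).card : ℝ) ≤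
      (2 * c + 2) * N := (card_window_le (c * N) v (by positivity) n).trans (by nlinarith)
  calc _ ≤ (2 * c + 2) * N * (C / N) ^ 2 := by gcongr
    _ = _ := by field_simp

theorem sum_abs_kernelWeight_mul_le {K : ℝ → ℝ} {c C N : ℝ}
    (hK : ∀ x : ℝ, c ≤ |x| → K x = 0) (hC : ∀ x : ℝ, |K x| ≤ C) (hN : 0 < N) (v : ℝ) (n : ℕ)
    (Z : ℕ → ℝ) (s a₁ a₂ : ℝ) (w₁ w₂ : ℤ → ℝ)
    (hZ : ∀ j ∈ Finset.Icc 1 n, |(j : ℝ) - v| < c * N →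
      |Z j| ≤ a₁ * geomSum s w₁ j + a₂ * geomSum s w₂ j) :
    ∑ j ∈ Finset.Icc 1 n, |kernelWeight K N v j| * |Z j| ≤
      C / N * (a₁ * windowSum s (c * N) v w₁ n + a₂ * windowSum s (c * N) v w₂ n) := by
  have h1 : ∑ j ∈ Finset.Icc 1 n with |((j : ℕ) : ℝ) - v| < c * N, |kernelWeight K N v j| * |Z j| =
      ∑ j ∈ Finset.Icc 1 n, |kernelWeight K N v j| * |Z j| := by
    refine Finset.sum_filter_of_ne fun j _ hj => ?_
    by_contra hcon
    exact hj (by rw [kernelWeight_eq_zero hK hN hcon]; simp)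
  rw [← h1, windowSum, windowSum, Finset.mul_sum, Finset.mul_sum, ← Finset.sum_add_distrib,
    Finset.mul_sum]
  refine Finset.sum_le_sum fun j hj => ?_
  rw [Finset.mem_filter] at hj
  have hC0 : 0 ≤ C := (abs_nonneg _).trans (hC 0)
  exact mul_le_mul (abs_kernelWeight_le hC hN v j) (hZ j hj.1 hj.2) (abs_nonneg _) (by positivity)

theorem dependsOn_frozenContrast (a₀ a B : ℝ) (k : ℕ) :
    DependsOn (fun x : ℤ → ℝ => frozenContrast a₀ a k (fun l => clip B (x l)) 0)
      (Icc (-(k : ℤ)) 0) := by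
  intro x y hxy
  have h1 : ∀ i ∈ Finset.range k, x (0 - 1 - (i : ℤ)) = y (0 - 1 - (i : ℤ)) := fun i hi =>
    hxy _ (by rw [Finset.mem_range] at hi; rw [mem_Icc]; omega)
  simp only [frozenContrast, movAvg, hxy 0 (by rw [mem_Icc]; omega)]
  rw [Finset.sum_congr rfl fun i hi => by rw [h1 i hi]]

theorem frozenContrast_shift (a₀ a : ℝ) (k : ℕ) (e : ℤ → ℝ) (j : ℤ) :
    frozenContrast a₀ a k (fun l => e (l + j)) 0 = frozenContrast a₀ a k e j := by
  simp only [frozenContrast, movAvg, zero_add]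
  congr 3
  exact Finset.sum_congr rfl fun i _ => by congr 2; ring

/-! ### Law of large numbers for the truncated frozen contrast -/

section LLN

variable {Ω : Type*} [MeasurableSpace Ω] {μ : Measure Ω} [IsProbabilityMeasure μ]
  {ξ : ℤ → Ω → ℝ}

/-- The law of large numbers for the frozen contrast of truncated innovations, uniformly over
a grid of locations. -/
theorem eventually_measure_frozen_le (hm : ∀ t, Measurable (ξ t)) (hi : iIndepFun ξ μ)
    (hd : ∀ t, IdentDistrib (ξ t) (ξ 0) μ μ) {K : ℝ → ℝ} (hK : IsLocalizingKernel K) {h : ℕ → ℝ}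
    (hN : Tendsto (fun n : ℕ => (n : ℝ) * h n) atTop atTop) (G : ℕ → Finset ℤ)
    (hG : ∀ c : ℝ, 0 < c →
      Tendsto (fun n : ℕ => ((G n).card : ℝ) * Real.exp (-c * (n * h n))) atTop (𝓝 0))
    {a₀ a B : ℝ} (ha₀ : |a₀| ≤ 1) (ha : |a| ≤ 1) (hB : 0 ≤ B) (k : ℕ) {τ δ : ℝ} (hτ : 0 < τ)
    (hδ : 0 < δ) :
    ∀ᶠ n : ℕ in atTop, μ {ω | ∃ v ∈ G n, τ ≤ |∑ j ∈ Finset.Icc 1 n,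
      kernelWeight K (n * h n) v j * (frozenContrast a₀ a k (fun l => clip B (ξ l ω)) j -
        ∫ ω, frozenContrast a₀ a k (fun l => clip B (ξ l ω)) 0 ∂μ)|} ≤ ENNReal.ofReal δ := by
  obtain ⟨c, hc, hsupp⟩ := hK.compact_support
  obtain ⟨C, hC⟩ := hK.bounded
  set b := B + 2 * (k * B) with hb
  set F : (ℤ → ℝ) → ℝ := fun x => frozenContrast a₀ a k (fun l => clip B (x l)) 0 with hF
  have hclip := (continuous_clip B).measurable
  have hFm : Measurable F := (measurable_frozenContrast a₀ a k 0).comp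
    (measurable_pi_lambda _ fun l => hclip.comp (measurable_pi_apply l))
  have hFb : ∀ x, F x ∈ Icc 0 b := fun x =>
    ⟨frozenContrast_nonneg _ _ _ _ _,
      frozenContrast_le ha₀ ha (fun l => abs_clip_le hB (x l)) k 0⟩
  have hFshift : ∀ (j : ℕ) ω, F (fun l => ξ (l + j) ω) =
      frozenContrast a₀ a k (fun l => clip B (ξ l ω)) j := fun j ω =>
    frozenContrast_shift a₀ a k (fun l => clip B (ξ l ω)) j
  have hFint : ∀ j : ℕ, ∫ ω, frozenContrast a₀ a k (fun l => clip B (ξ l ω)) j ∂μ =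
      ∫ ω, frozenContrast a₀ a k (fun l => clip B (ξ l ω)) 0 ∂μ := fun j => by
    simp only [← hFshift]
    exact ((identDistrib_shift hm hi hd (j : ℤ)).comp hFm).integral_eq
  -- The added `1` keeps the variance proxy positive when `B = 0`.
  set V₀ := (2 * c + 2) * C ^ 2 * b ^ 2 + 1 with hV₀
  have hV₀pos : 0 < V₀ := by positivity
  set c' := (τ / (k + 1)) ^ 2 / (2 * V₀) with hc'
  have hc'0 : 0 < c' := by positivity
  have hlim := ((hG c' hc'0).const_mul (2 * ((k : ℝ) + 1)))
  rw [mul_zero] at hlim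
  filter_upwards [hlim.eventually_le_const hδ, hN.eventually_ge_atTop 1] with n hn1 hn2
  set N := (n : ℝ) * h n with hNdef
  have hN0 : 0 < N := by linarith
  have hone : ∀ v ∈ G n, μ.real {ω | τ ≤ |∑ j ∈ Finset.Icc 1 n, kernelWeight K N v j *
      (frozenContrast a₀ a k (fun l => clip B (ξ l ω)) j -
        ∫ ω, frozenContrast a₀ a k (fun l => clip B (ξ l ω)) 0 ∂μ)|} ≤
      2 * (k + 1) * Real.exp (-c' * N) := fun v _ => by
    have h1 := measure_abs_sum_ge_le_of_dependsOn hm hi F hFm k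
      (dependsOn_frozenContrast a₀ a B k) b hFb (Finset.Icc 1 n) (kernelWeight K N v) (V₀ / N) ?_
      τ hτ.le
    · simp only [hFshift, hFint] at h1
      refine h1.trans (le_of_eq ?_)
      rw [hc']
      congr 2
      field_simp
    · rw [← Finset.sum_mul]
      calc _ ≤ (2 * c + 2) * C ^ 2 / N * b ^ 2 := by
            gcongr; exact sum_sq_kernelWeight_le hc hsupp hC hn2 v n
        _ = (2 * c + 2) * C ^ 2 * b ^ 2 / N := by ring
        _ ≤ V₀ / N := by gcongr; rw [hV₀]; linarith
  rw [ENNReal.le_ofReal_iff_toReal_le (measure_ne_top _ _) hδ.le]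
  refine le_trans ?_ hn1
  have hcover : {ω | ∃ v ∈ G n, τ ≤ |∑ j ∈ Finset.Icc 1 n,
      kernelWeight K N v j * (frozenContrast a₀ a k (fun l => clip B (ξ l ω)) j -
        ∫ ω, frozenContrast a₀ a k (fun l => clip B (ξ l ω)) 0 ∂μ)|} ⊆
      ⋃ v ∈ G n, {ω | τ ≤ |∑ j ∈ Finset.Icc 1 n, kernelWeight K N v j *
      (frozenContrast a₀ a k (fun l => clip B (ξ l ω)) j -
        ∫ ω, frozenContrast a₀ a k (fun l => clip B (ξ l ω)) 0 ∂μ)|} := by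
    rintro ω ⟨v, hv, hle⟩
    exact mem_biUnion hv hle
  refine (measureReal_mono hcover (measure_ne_top _ _)).trans ?_
  refine (measureReal_biUnion_finset_le _ _).trans ((Finset.sum_le_sum hone).trans (le_of_eq ?_))
  rw [Finset.sum_const, nsmul_eq_mul]
  ring

omit [IsProbabilityMeasure μ] in
/-- Effect of the truncation on the expected frozen contrast. -/
theorem abs_integral_frozenContrast_clip_sub_le (hm : ∀ t, Measurable (ξ t))
    (hd : ∀ t, IdentDistrib (ξ t) (ξ 0) μ μ) (hint : ∀ t, Integrable (ξ t) μ) {a₀ a B : ℝ}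
    (ha₀ : |a₀| ≤ 1) (ha : |a| ≤ 1) (hB : 0 ≤ B) (k : ℕ) :
    |∫ ω, frozenContrast a₀ a k (fun l => clip B (ξ l ω)) 0 ∂μ -
      ∫ ω, frozenContrast a₀ a k (fun l => ξ l ω) 0 ∂μ| ≤
      (1 + 2 * k) * ∫ ω, |ξ 0 ω - clip B (ξ 0 ω)| ∂μ := by
  have hclip := (continuous_clip B).measurable
  have hci : ∀ t, Integrable (fun ω => clip B (ξ t ω)) μ := fun t => by
    refine (hint t).abs.mono' (hclip.comp (hm t)).aestronglyMeasurable (ae_of_all _ fun ω => ?_)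
    exact abs_clip_le_abs hB _
  have hwi : ∀ t, Integrable (fun ω => |ξ t ω - clip B (ξ t ω)|) μ := fun t =>
    integrable_abs_sub_clip (hm t) (hint t) hB
  have hi1 := integrable_frozenContrast hint a₀ a k 0
  have hi2 := integrable_frozenContrast (ξ := fun t ω => clip B (ξ t ω)) hci a₀ a k 0
  have hsum : Integrable (fun ω => ∑ i ∈ Finset.range k,
      |ξ (0 - 1 - i) ω - clip B (ξ (0 - 1 - i) ω)|) μ := integrable_finsetSum _ fun i _ => hwi _
  rw [← integral_sub hi2 hi1]
  refine (abs_integral_le_integral_abs).trans ?_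
  have hle : ∀ ω, |frozenContrast a₀ a k (fun l => clip B (ξ l ω)) 0 -
      frozenContrast a₀ a k (fun l => ξ l ω) 0| ≤ |ξ 0 ω - clip B (ξ 0 ω)| +
        2 * ∑ i ∈ Finset.range k, |ξ (0 - 1 - i) ω - clip B (ξ (0 - 1 - i) ω)| := fun ω => by
    rw [abs_sub_comm]
    refine (abs_frozenContrast_sub_le ha₀ ha _ _ k 0).trans ?_
    gcongr
    refine (Finset.abs_sum_le_sum_abs _ _).trans (Finset.sum_le_sum fun i _ => ?_)
    rw [abs_mul, abs_pow]
    exact mul_le_of_le_one_left (abs_nonneg _) (pow_le_one₀ (abs_nonneg _) ha₀)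
  refine (integral_mono (hi2.sub hi1).abs ((hwi 0).add (hsum.const_mul 2)) hle).trans
    (le_of_eq ?_)
  have e1 : ∫ ω, (|ξ 0 ω - clip B (ξ 0 ω)| +
        2 * ∑ i ∈ Finset.range k, |ξ (0 - 1 - i) ω - clip B (ξ (0 - 1 - i) ω)|) ∂μ =
      ∫ ω, |ξ 0 ω - clip B (ξ 0 ω)| ∂μ + 2 * ∑ i ∈ Finset.range k,
        ∫ ω, |ξ (0 - 1 - i) ω - clip B (ξ (0 - 1 - i) ω)| ∂μ := by
    rw [integral_add (hwi 0) (hsum.const_mul 2), integral_const_mul,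
      integral_finsetSum _ fun i _ => hwi _]
  refine e1.trans ?_
  simp only [integral_abs_sub_clip_eq hd B]
  rw [Finset.sum_const, Finset.card_range, nsmul_eq_mul]
  ring

end LLN

/-! ### Consequences of local stationarity, and finite nets -/

/-- `θ*(u)` is the limit of the coefficients at time `⌈n u⌉`, and `[-r, r]` is closed. Hence `θ*(u)`
is an admissible competitor for the minimizer. -/
theorem LocallyStationary.abs_limit_le {ρ r : ℝ} (hρ : 0 < ρ) {θ : ℕ → ℕ → ℝ} {θstar : ℝ → ℝ}
    (hLS : LocallyStationary ρ θ θstar)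
    (hθ : ∀ n t : ℕ, 1 ≤ t → t ≤ n → θ n t ∈ Icc (-r) r) {u : ℝ} (hu : u ∈ Ioo (0 : ℝ) 1) :
    |θstar u| ≤ r := by
  obtain ⟨-, C, hC, hLS⟩ := hLS
  have h1 : Tendsto (fun n : ℕ => r + C * (1 / (n : ℝ)) ^ ρ) atTop (𝓝 (r + C * 0 ^ ρ)) :=
    ((tendsto_const_div_atTop_nhds_zero_nat 1).rpow_const (Or.inr hρ.le)).const_mul C
      |>.const_add r
  rw [Real.zero_rpow hρ.ne', mul_zero, add_zero] at h1
  refine ge_of_tendsto h1 ?_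
  filter_upwards [eventually_ge_atTop 1] with n hn
  have hn0 : (0 : ℝ) < n := by exact_mod_cast hn
  have hnu : 0 < (n : ℝ) * u := mul_pos hn0 hu.1
  have ht1 : 1 ≤ ⌈(n : ℝ) * u⌉₊ := Nat.ceil_pos.2 hnu
  have ht2 : ⌈(n : ℝ) * u⌉₊ ≤ n := Nat.ceil_le.2 (by nlinarith [hu.2])
  have h2 := hLS n hn _ ht1 ht2 u ⟨hu.1.le, hu.2.le⟩
  have h3 := abs_le.2 (hθ n _ ht1 ht2)
  have h4 : |u - (⌈(n : ℝ) * u⌉₊ : ℝ) / n| ≤ 1 / n := by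
    have h5 := Nat.le_ceil ((n : ℝ) * u)
    have h6 := Nat.ceil_lt_add_one hnu.le
    rw [show u - (⌈(n : ℝ) * u⌉₊ : ℝ) / n = (n * u - ⌈(n : ℝ) * u⌉₊) / n by field_simp, abs_div,
      abs_of_pos hn0]
    gcongr
    rw [abs_le]
    constructor <;> linarith
  have h7 : C * |u - (⌈(n : ℝ) * u⌉₊ : ℝ) / n| ^ ρ ≤ C * (1 / (n : ℝ)) ^ ρ := by gcongr
  have h8 := abs_sub_abs_le_abs_sub (θstar u) (θ n ⌈(n : ℝ) * u⌉₊)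
  rw [abs_sub_comm] at h8
  linarith

/-- The times involved lie within `c h n + (k + 1)/n` of `u` after rescaling, so the Hölder bound is
uniform over `U`. The condition `k + 1 ≤ j` ensures that the `k` innovations before `j` all come
after time `0`. -/
theorem LocallyStationary.eventually_near {ρ : ℝ} (hρ : 0 < ρ) {θ : ℕ → ℕ → ℝ} {θstar : ℝ → ℝ}
    (hLS : LocallyStationary ρ θ θstar) {h : ℕ → ℝ} (hh_pos : ∀ n, 0 < h n)
    (hh_lim : Tendsto h atTop (𝓝 0)) {ε : ℝ} (hε : 0 < ε) {U : Set ℝ} (hU : U ⊆ Icc ε (1 - ε))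
    {c d : ℝ} (hc : 0 < c) (hd : 0 < d) (k : ℕ) :
    ∀ᶠ n : ℕ in atTop, ∀ u ∈ U, ∀ j ∈ Finset.Icc 1 n, |(j : ℝ) - n * u| < c * (n * h n) →
      k + 1 ≤ j ∧ ∀ l, j ≤ l + k → l ≤ j → |θ n l - θstar u| ≤ d := by
  obtain ⟨-, C, hC, hLS⟩ := hLS
  have h0 : Tendsto (fun n : ℕ => c * h n + (k + 1 : ℝ) / n) atTop (𝓝 (c * 0 + 0)) :=
    (hh_lim.const_mul c).add (tendsto_const_div_atTop_nhds_zero_nat _)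
  rw [mul_zero, add_zero] at h0
  have h1 : Tendsto (fun n : ℕ => C * (c * h n + (k + 1 : ℝ) / n) ^ ρ) atTop
      (𝓝 (C * 0 ^ ρ)) := (h0.rpow_const (Or.inr hρ.le)).const_mul C
  rw [Real.zero_rpow hρ.ne', mul_zero] at h1
  filter_upwards [h0.eventually_le_const hε, h1.eventually_le_const hd, eventually_ge_atTop 1]
    with n hn1 hn2 hn3 u hu j hj hju
  have hn0 : (0 : ℝ) < n := by exact_mod_cast hn3
  have hh := hh_pos n
  obtain ⟨hu1, hu2⟩ := hU hu
  rw [Finset.mem_Icc] at hj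
  rw [abs_lt] at hju
  have h2 : c * (n * h n) + (k + 1) ≤ n * ε := by
    calc c * (n * h n) + (k + 1) = n * (c * h n + (k + 1 : ℝ) / n) := by field_simp
      _ ≤ n * ε := by gcongr
  have hkj : k + 1 ≤ j := by
    have : ((k + 1 : ℕ) : ℝ) < j := by push_cast; nlinarith
    exact (Nat.cast_lt.1 this).le
  refine ⟨hkj, fun l hl1 hl2 => ?_⟩
  refine (hLS n hn3 l (by omega) (by omega) u ⟨by linarith, by linarith⟩).trans (le_trans ?_ hn2)
  gcongr
  rw [show u - (l : ℝ) / n = (n * u - l) / n by field_simp, abs_div, abs_of_pos hn0,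
    div_le_iff₀ hn0, add_mul, div_mul_cancel₀ _ hn0.ne', abs_le]
  have h3 : (j : ℝ) ≤ l + k := by exact_mod_cast hl1
  have h4 : (l : ℝ) ≤ j := by exact_mod_cast hl2
  constructor <;> nlinarith

theorem exists_finite_net (r : ℝ) {d : ℝ} (hd : 0 < d) :
    ∃ T : Finset ℝ, (∀ a ∈ T, |a| ≤ r) ∧ ∀ x, |x| ≤ r → ∃ a ∈ T, |x - a| ≤ d := by
  obtain ⟨t, ht, htf, hcov⟩ := (isCompact_Icc (a := -r) (b := r)).finite_cover_balls hd
  refine ⟨htf.toFinset, fun a ha => abs_le.2 (ht (htf.mem_toFinset.1 ha)), fun x hx => ?_⟩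
  obtain ⟨a, ha, hxa⟩ := mem_iUnion₂.1 (hcov (abs_le.1 hx))
  exact ⟨a, htf.mem_toFinset.2 ha, (Metric.mem_ball.1 hxa).le⟩

theorem exists_pos_mul_le {X t : ℝ} (hX : 0 ≤ X) (ht : 0 < t) : ∃ d, 0 < d ∧ X * d ≤ t := by
  refine ⟨t / (X + 1), by positivity, ?_⟩
  rw [mul_div_assoc', div_le_iff₀ (by positivity)]
  nlinarith

/-! ### Uniform approximation of the localized contrast -/

section LLN

variable {Ω : Type*} [MeasurableSpace Ω] {μ : Measure Ω} [IsProbabilityMeasure μ]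
  {ξ : ℤ → Ω → ℝ}

omit [IsProbabilityMeasure μ] in
/-- Tightness of the local averages of the absolute innovations. -/
theorem NegligibleTails.exists_bound {h : ℕ → ℝ} {U : Set ℝ} (hT : NegligibleTails μ ξ h U)
    (hN : Tendsto (fun n : ℕ => (n : ℝ) * h n) atTop atTop) {s c δ : ℝ} (hs : 0 < s) (hs1 : s < 1)
    (hc : 0 < c) (hδ : 0 < δ) :
    ∃ C : ℝ, 0 ≤ C ∧ ∀ᶠ n : ℕ in atTop, μ {ω | ∃ u ∈ U, C * (n * h n) <
      windowSum s (c * (n * h n)) (n * u) (fun l => |ξ l ω|) n} ≤ ENNReal.ofReal δ := by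
  obtain ⟨B, hB, hBn⟩ := hT s c δ 1 hs hs1 hc hδ one_pos
  have h1s : 0 < 1 - s := by linarith
  refine ⟨(2 * c + 2) * (B / (1 - s)) + 1, by positivity, ?_⟩
  filter_upwards [hBn B le_rfl, hN.eventually_ge_atTop 1] with n hn1 hn2
  refine (measure_mono ?_).trans hn1
  rintro ω ⟨u, hu, hlt⟩
  refine ⟨u, hu, ?_⟩
  have h1 := windowSum_mono hs.le (c * (n * h n)) (n * u)
    (fun l => abs_le_add_abs_sub_clip hB (ξ l ω)) n
  have hN0 : 0 ≤ (n : ℝ) * h n := by linarith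
  have h2 := windowSum_const_add_le hs.le hs1 hB (M := c * (n * h n)) (by positivity) (n * u)
    (fun l => |ξ l ω - clip B (ξ l ω)|) n
  have h3 : 0 ≤ B / (1 - s) := by positivity
  nlinarith

set_option maxHeartbeats 1000000 in
/-- The localized LAV contrast is uniformly close to the frozen contrast on finite nets. -/
theorem exists_net_eventually_measure_le (hm : ∀ t, Measurable (ξ t)) (hi : iIndepFun ξ μ)
    (hd : ∀ t, IdentDistrib (ξ t) (ξ 0) μ μ) (hint : ∀ t, Integrable (ξ t) μ)
    {r ρ : ℝ} (hr0 : 0 < r) (hr1 : r < 1) (hρ : 0 < ρ) {θ : ℕ → ℕ → ℝ} {θstar : ℝ → ℝ}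
    (hθ : ∀ n t : ℕ, 1 ≤ t → t ≤ n → θ n t ∈ Icc (-r) r) (hLS : LocallyStationary ρ θ θstar)
    {K : ℝ → ℝ} (hK : IsLocalizingKernel K) {h : ℕ → ℝ} (hh_pos : ∀ n, 0 < h n)
    (hh_lim : Tendsto h atTop (𝓝 0))
    (hN : Tendsto (fun n : ℕ => (n : ℝ) * h n) atTop atTop) {ε : ℝ} (hε : 0 < ε) {U : Set ℝ}
    (hU : U ⊆ Icc ε (1 - ε)) (hT : NegligibleTails μ ξ h U) (G : ℕ → Finset ℤ)
    (hGU : ∀ n, ∀ u ∈ U, ⌊(n : ℝ) * u⌋ ∈ G n)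
    (hG : ∀ c : ℝ, 0 < c →
      Tendsto (fun n : ℕ => ((G n).card : ℝ) * Real.exp (-c * (n * h n))) atTop (𝓝 0))
    {τ δ D : ℝ} (hτ : 0 < τ) (hδ : 0 < δ) (hD : 0 < D) :
    ∃ (k : ℕ) (d : ℝ) (T : Finset ℝ), 1 ≤ k ∧ 0 < d ∧ d ≤ D ∧ (∀ a ∈ T, |a| ≤ r) ∧
      (∀ x, |x| ≤ r → ∃ a ∈ T, |x - a| ≤ d) ∧ ∀ᶠ n : ℕ in atTop,
      μ {ω | ∃ u ∈ U, ∃ a₀ ∈ T, ∃ a ∈ T, ∃ x, |θstar u - a₀| ≤ d ∧ |x - a| ≤ d ∧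
        τ < |localizedContrast lavContrast K (h n) n (fun t => tvAR1 θ ξ n t ω) u x -
          ∫ ω, frozenContrast a₀ a k (fun l => ξ l ω) 0 ∂μ|} ≤ ENNReal.ofReal δ := by
  obtain ⟨c, hc, hsupp⟩ := hK.compact_support
  obtain ⟨C, hC⟩ := hK.bounded
  have hC0 : 0 ≤ C := (abs_nonneg _).trans (hC 0)
  have hτ8 : 0 < τ / 8 := by positivity
  have hδ3 : 0 < δ / 3 := by positivity
  set s := (1 + r) / 2 with hs
  have hs0 : 0 < s := by rw [hs]; linarith
  have hrs : r < s := by rw [hs]; linarith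
  have hs1 : s < 1 := by rw [hs]; linarith
  obtain ⟨C₁, hC₁, hev₁⟩ := hT.exists_bound hN hs0 hs1 hc hδ3
  -- The constants are chosen in a fixed order: the tightness bound `C₁`, the memory `k`, the mesh
  -- `d` (depending on `k`) with its net `T`, and only then the truncation level `B`. Seven errors
  -- of size `τ / 8` and three events of probability `δ / 3` result.
  obtain ⟨k, hk1, hk⟩ : ∃ k : ℕ, 1 ≤ k ∧ C * C₁ / s * 2 * (r / s) ^ k ≤ τ / 8 := by
    have h1 := (tendsto_pow_atTop_nhds_zero_of_lt_one (r := r / s) (by positivity)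
      ((div_lt_one hs0).2 hrs)).const_mul (C * C₁ / s * 2)
    rw [mul_zero] at h1
    obtain ⟨k, hk1, hk⟩ := ((eventually_ge_atTop 1).and (h1.eventually_le_const hτ8)).exists
    exact ⟨k, hk1, hk⟩
  obtain ⟨d₀, hd₀, hd₀τ⟩ := exists_pos_mul_le (X := C * C₁ / s * (3 + 4 * k / s)) (by positivity) hτ8
  set d := min d₀ D with hd_def
  have hd0 : 0 < d := lt_min hd₀ hD
  have hdτ : C * C₁ / s * (3 + 4 * k / s) * d ≤ τ / 8 :=
    le_trans (by gcongr; exact min_le_left _ _) hd₀τ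
  obtain ⟨T, hTr, hTnet⟩ := exists_finite_net r hd0
  refine ⟨k, d, T, hk1, hd0, min_le_right _ _, hTr, hTnet, ?_⟩
  obtain ⟨η, hη, hητ⟩ := exists_pos_mul_le (X := C * (2 / s)) (by positivity) hτ8
  obtain ⟨B₁, hB₁, hev₂⟩ := hT s c (δ / 3) η hs0 hs1 hc hδ3 hη
  obtain ⟨κ, hκ, hκτ⟩ := exists_pos_mul_le (X := 1 + 2 * (k : ℝ)) (by positivity) hτ8
  obtain ⟨B₂, hB₂, hB₂τ⟩ := exists_integral_abs_sub_clip_le (hm 0) (hint 0) hκ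
  set B := max B₁ B₂ with hB_def
  have hB : 0 ≤ B := hB₁.trans (le_max_left _ _)
  have htrunc := (mul_le_mul_of_nonneg_left (hB₂τ B (le_max_right _ _))
    (by positivity : (0 : ℝ) ≤ 1 + 2 * k)).trans hκτ
  set b := B + 2 * (k * B) with hb_def
  have hb0 : 0 ≤ b := by positivity
  obtain ⟨κ₂, hκ₂, hκ₂τ⟩ := exists_pos_mul_le (X := 2 * b) (by positivity) hτ8
  obtain ⟨κ₃, hκ₃, hκ₃τ⟩ := exists_pos_mul_le hb0 hτ8
  -- The share of `δ / 3` for each pair of net points; the added `1` avoids division by zero.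
  set δ' := δ / 3 / ((T ×ˢ T).card + 1) with hδ'_def
  have hδ' : 0 < δ' := by positivity
  have hT1 : ∀ a ∈ T, |a| ≤ 1 := fun a ha => (hTr a ha).trans hr1.le
  have hev₃ : ∀ᶠ n : ℕ in atTop, ∀ q ∈ T ×ˢ T, μ {ω | ∃ v ∈ G n, τ / 8 ≤ |∑ j ∈ Finset.Icc 1 n,
      kernelWeight K (n * h n) v j * (frozenContrast q.1 q.2 k (fun l => clip B (ξ l ω)) j -
        ∫ ω, frozenContrast q.1 q.2 k (fun l => clip B (ξ l ω)) 0 ∂μ)|} ≤ ENNReal.ofReal δ' := by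
    rw [Finset.eventually_all]
    intro q hq
    rw [Finset.mem_product] at hq
    exact eventually_measure_frozen_le hm hi hd hK hN G hG (hT1 _ hq.1) (hT1 _ hq.2) hB k hτ8 hδ'
  filter_upwards [hev₁, hev₂ B (le_max_left _ _), hev₃,
    eventually_abs_sum_kernelWeight_sub_one hK hh_lim hN hε hU hκ₃,
    eventually_sum_abs_kernelWeight_sub hK hh_lim hN hε hU hκ₂,
    LocallyStationary.eventually_near hρ hLS hh_pos hh_lim hε hU hc hd0 k,
    hN.eventually_gt_atTop 0, eventually_ge_atTop 1] with n hE₁ hE₂ hE₃ hR₁ hR₂ hnear hNpos hn1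
  set N := (n : ℝ) * h n with hNdef
  have hcover : {ω | ∃ u ∈ U, ∃ a₀ ∈ T, ∃ a ∈ T, ∃ x, |θstar u - a₀| ≤ d ∧ |x - a| ≤ d ∧
        τ < |localizedContrast lavContrast K (h n) n (fun t => tvAR1 θ ξ n t ω) u x -
          ∫ ω, frozenContrast a₀ a k (fun l => ξ l ω) 0 ∂μ|} ⊆
      ({ω | ∃ u ∈ U, C₁ * N < windowSum s (c * N) (n * u) (fun l => |ξ l ω|) n} ∪
       {ω | ∃ u ∈ U, η * N <
          windowSum s (c * N) (n * u) (fun l => |ξ l ω - clip B (ξ l ω)|) n}) ∪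
      ⋃ q ∈ T ×ˢ T, {ω | ∃ v ∈ G n, τ / 8 ≤ |∑ j ∈ Finset.Icc 1 n,
        kernelWeight K N v j * (frozenContrast q.1 q.2 k (fun l => clip B (ξ l ω)) j -
        ∫ ω, frozenContrast q.1 q.2 k (fun l => clip B (ξ l ω)) 0 ∂μ)|} := by
    rintro ω ⟨u, hu, a₀, ha₀, a, ha, x, hua₀, hxa, hlt⟩
    by_contra hcon
    simp only [mem_union, mem_iUnion, mem_ofPred_eq, not_or, not_exists, not_and, not_lt,
      not_le] at hcon
    obtain ⟨⟨hc₁, hc₂⟩, hc₃⟩ := hcon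
    have hw₁ := hc₁ u hu
    have hw₂ := hc₂ u hu
    have hw₃ := (hc₃ (a₀, a) (Finset.mem_product.2 ⟨ha₀, ha⟩) _ (hGU n u hu)).le
    rw [localizedContrast_lav_tvAR1 K hn1, ← hNdef] at hlt
    set e : ℤ → ℝ := fun l => ξ l ω with he
    set gB := ∫ ω, frozenContrast a₀ a k (fun l => clip B (ξ l ω)) 0 ∂μ with hgB
    have hfb : ∀ (f : ℤ → ℝ) (j : ℤ), |frozenContrast a₀ a k (fun l => clip B (f l)) j| ≤ b :=
      fun f j => by
        rw [abs_of_nonneg (frozenContrast_nonneg _ _ _ _ _)]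
        exact frozenContrast_le (hT1 _ ha₀) (hT1 _ ha) (fun l => abs_clip_le hB _) k j
    have hgBb : |gB| ≤ b := by
      have h1 := norm_integral_le_of_norm_le_const (μ := μ) (C := b)
        (ae_of_all _ fun ω => (Real.norm_eq_abs _).le.trans (hfb (fun l => ξ l ω) 0))
      rwa [probReal_univ, mul_one, Real.norm_eq_abs] at h1
    have hmain := abs_weighted_sum_sub_le (Finset.Icc 1 n) (kernelWeight K N (n * u))
      (kernelWeight K N (⌊(n : ℝ) * u⌋ : ℤ))
      (fun j => |ar1Rec (θ n) e j - x * ar1Rec (θ n) e (j - 1)|)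
      (fun j => frozenContrast a₀ a k (fun l => clip B (e l)) j)
      (g := ∫ ω, frozenContrast a₀ a k (fun l => ξ l ω) 0 ∂μ) (fun j _ => hfb e j) hgBb
    -- The coefficients lie within `2 d` of `a₀`: `d` from local stationarity and `d` from the net.
    set a₁ := (2 * d + d + 2 * ((r / s) ^ k + k * (2 * d) / s)) / s with ha₁
    have hpt : ∀ j ∈ Finset.Icc 1 n, |(j : ℝ) - n * u| < c * N →
        |(|ar1Rec (θ n) e j - x * ar1Rec (θ n) e (j - 1)|) -
          frozenContrast a₀ a k (fun l => clip B (e l)) j| ≤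
        a₁ * geomSum s (fun l => |e l|) j + 2 / s * geomSum s (fun l => |e l - clip B (e l)|) j := by
      intro j hj hju
      obtain ⟨hkj, hθj⟩ := hnear u hu j hj hju
      rw [Finset.mem_Icc] at hj
      obtain ⟨t, rfl⟩ : ∃ t, j = t + 1 := ⟨j - 1, by omega⟩
      refine abs_lav_sub_frozenContrast_le hr0.le hrs.le hs0 hs1.le (by positivity) (hTr _ ha₀)
        (hTr _ ha) hxa (θ n) e k t (by omega)
        (fun l h1 h2 => abs_le.2 (hθ n l h1 (by omega))) fun l h1 h2 => ?_
      have h3 := hθj l (by omega) h2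
      have h4 := abs_sub_le (θ n l) (θstar u) a₀
      linarith
    have hA := sum_abs_kernelWeight_mul_le hsupp hC hNpos (n * u) n _ s a₁ (2 / s) _ _ hpt
    have ha₁0 : 0 ≤ a₁ := by positivity
    have hA' : C / N * (a₁ * windowSum s (c * N) (n * u) (fun l => |e l|) n +
        2 / s * windowSum s (c * N) (n * u) (fun l => |e l - clip B (e l)|) n) ≤
        τ / 8 + τ / 8 + τ / 8 := by
      calc _ ≤ C / N * (a₁ * (C₁ * N) + 2 / s * (η * N)) := by gcongr
        _ = C * C₁ / s * 2 * (r / s) ^ k + C * C₁ / s * (3 + 4 * k / s) * d +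
            C * (2 / s) * η := by
          rw [ha₁]; field_simp; ring
        _ ≤ _ := by gcongr
    have h2 : b * (2 * ∑ j ∈ Finset.Icc 1 n, |kernelWeight K N (n * u) j -
        kernelWeight K N (⌊(n : ℝ) * u⌋ : ℤ) j|) ≤ τ / 8 := by
      refine le_trans ?_ hκ₂τ
      rw [← mul_assoc, mul_comm b 2]
      have := (hR₂ u hu).le
      gcongr
    have h3 : b * |∑ j ∈ Finset.Icc 1 n, kernelWeight K N (n * u) j - 1| ≤ τ / 8 := by
      refine le_trans ?_ hκ₃τ
      have := (hR₁ u hu).le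
      gcongr
    have h4 := (abs_integral_frozenContrast_clip_sub_le hm hd hint (hT1 _ ha₀) (hT1 _ ha) hB
      k).trans htrunc
    linarith
  refine (measure_mono hcover).trans ?_
  refine (measure_union_le _ _).trans ((add_le_add (measure_union_le _ _) le_rfl).trans ?_)
  have h3 : μ (⋃ q ∈ T ×ˢ T, {ω | ∃ v ∈ G n, τ / 8 ≤ |∑ j ∈ Finset.Icc 1 n,
        kernelWeight K N v j * (frozenContrast q.1 q.2 k (fun l => clip B (ξ l ω)) j -
        ∫ ω, frozenContrast q.1 q.2 k (fun l => clip B (ξ l ω)) 0 ∂μ)|}) ≤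
        ENNReal.ofReal (δ / 3) := by
    refine (measure_biUnion_finset_le _ _).trans ((Finset.sum_le_sum hE₃).trans ?_)
    rw [Finset.sum_const, nsmul_eq_mul, ← ENNReal.ofReal_natCast, ← ENNReal.ofReal_mul (by positivity)]
    refine ENNReal.ofReal_le_ofReal ?_
    rw [hδ'_def, mul_div_assoc', div_le_iff₀ (by positivity), mul_add, mul_comm]
    linarith
  refine (add_le_add (add_le_add hE₁ hE₂) h3).trans (le_of_eq ?_)
  rw [← ENNReal.ofReal_add hδ3.le hδ3.le, ← ENNReal.ofReal_add (by positivity) hδ3.le]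
  congr 1
  ring

end LLN

/-! ### From uniform approximation to consistency -/

section Consistency

variable {Ω : Type*} [MeasurableSpace Ω] {μ : Measure Ω} [IsProbabilityMeasure μ]
  {ξ : ℤ → Ω → ℝ}

/-- Consistency of the localized LAV estimator, uniformly over a set `U` of locations. -/
theorem tendsto_measure_exists_abs_sub_ge (hm : ∀ t, Measurable (ξ t)) (hi : iIndepFun ξ μ)
    (hd : ∀ t, IdentDistrib (ξ t) (ξ 0) μ μ) (hint : ∀ t, Integrable (ξ t) μ)
    (hmed : ∀ m : ℝ, IsMedian μ (ξ 0) m ↔ m = 0) (hne : ¬ ∀ᵐ ω ∂μ, ξ 0 ω = 0)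
    {r ρ : ℝ} (hr0 : 0 < r) (hr1 : r < 1) (hρ : 0 < ρ) {θ : ℕ → ℕ → ℝ} {θstar : ℝ → ℝ}
    (hθ : ∀ n t : ℕ, 1 ≤ t → t ≤ n → θ n t ∈ Icc (-r) r) (hLS : LocallyStationary ρ θ θstar)
    {K : ℝ → ℝ} (hK : IsLocalizingKernel K) {h : ℕ → ℝ} (hh_pos : ∀ n, 0 < h n)
    (hh_lim : Tendsto h atTop (𝓝 0))
    (hN : Tendsto (fun n : ℕ => (n : ℝ) * h n) atTop atTop) {θhat : ℕ → ℝ → Ω → ℝ}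
    (hθhat : IsLocalizedLAVEstimator r K h (tvAR1 θ ξ) θhat) {ε : ℝ} (hε : 0 < ε) {U : Set ℝ}
    (hU : U ⊆ Icc ε (1 - ε)) (hT : NegligibleTails μ ξ h U) (G : ℕ → Finset ℤ)
    (hGU : ∀ n, ∀ u ∈ U, ⌊((n : ℕ) : ℝ) * u⌋ ∈ G n)
    (hG : ∀ c : ℝ, 0 < c →
      Tendsto (fun n : ℕ => ((G n).card : ℝ) * Real.exp (-c * (n * h n))) atTop (𝓝 0))
    {η : ℝ} (hη : 0 < η) :
    Tendsto (fun n => μ {ω | ∃ u ∈ U, η ≤ |θhat n u ω - θstar u|}) atTop (𝓝 0) := by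
  obtain ⟨γ, hγ, hgap⟩ := exists_gap hm hi hd hint hmed hne (η := η / 2) (by positivity)
  rw [ENNReal.tendsto_nhds_zero]
  intro δ hδ
  obtain ⟨δ', hδ', hδδ⟩ := ENNReal.lt_iff_exists_nnreal_btwn.1 hδ
  have hδ'0 : (0 : ℝ) < δ' := by exact_mod_cast hδ'
  -- With mesh at most `η / 8`, an error of at least `η` leaves the net points `a₀` and `a` more
  -- than `η / 2` apart. Two approximation errors of `γ / 3` cannot then bridge the gap `γ`, which
  -- contradicts the minimality of the estimator against `θ*(u)`.
  obtain ⟨k, d, T, hk, hd0, hdD, hTr, hTnet, hev⟩ := exists_net_eventually_measure_le hm hi hd hint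
    hr0 hr1 hρ hθ hLS hK hh_pos hh_lim hN hε hU hT G hGU hG (τ := γ / 3) (δ := δ') (D := η / 8)
    (by positivity) hδ'0 (by positivity)
  filter_upwards [hev, eventually_ge_atTop 1] with n hn hn1
  refine (measure_mono ?_).trans (hn.trans ?_)
  · rintro ω ⟨u, hu, hle⟩
    by_contra hcon
    simp only [mem_ofPred_eq, not_exists, not_and, not_lt] at hcon
    obtain ⟨hu1, hu2⟩ := hU hu
    have hu01 : u ∈ Ioo (0 : ℝ) 1 := ⟨by linarith, by linarith⟩
    obtain ⟨hmem, hmin⟩ := hθhat n hn1 u hu01 ω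
    have hstar := LocallyStationary.abs_limit_le hρ hLS hθ hu01
    obtain ⟨a₀, ha₀, hua₀⟩ := hTnet _ hstar
    obtain ⟨a, ha, hxa⟩ := hTnet _ (abs_le.2 hmem)
    have h1 := abs_le.1 (hcon u hu a₀ ha₀ a ha _ hua₀ hxa)
    have h2 := abs_le.1 (hcon u hu a₀ ha₀ a₀ ha₀ _ hua₀ hua₀)
    have h3 := isMinOn_iff.1 hmin (θstar u) (abs_le.1 hstar)
    have h4 := hgap k a₀ a hk (by
      have h5 := abs_sub_le (θhat n u ω) a (θstar u)
      have h6 := abs_sub_le a a₀ (θstar u)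
      rw [abs_sub_comm (θstar u)] at hua₀
      rw [abs_sub_comm a a₀] at h6
      linarith)
    linarith [h1.1, h2.2]
  · rw [ENNReal.ofReal_coe_nnreal]
    exact hδδ.le

end Consistency

/-- Eventually `n ≤ (n h)^p`, so the number of grid centres is polynomial in `n h` and is beaten by
the exponential Hoeffding bound. -/
theorem tendsto_card_mul_exp_neg {h : ℕ → ℝ} (hh_pos : ∀ n, 0 < h n) {p : ℝ} (hp : 1 < p)
    (hN : Tendsto (fun n : ℕ => (n : ℝ) ^ (1 - 1 / p) * h n) atTop atTop) {c : ℝ} (hc : 0 < c) :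
    Tendsto (fun n : ℕ => ((Finset.Icc (0 : ℤ) n).card : ℝ) * Real.exp (-c * (n * h n))) atTop
      (𝓝 0) := by
  have h1 := ((tendsto_rpow_mul_exp_neg_mul_atTop_nhds_zero p c hc).comp
    (tendsto_natCast_mul_of_tendsto_rpow hh_pos hp hN)).const_mul 2
  rw [mul_zero] at h1
  refine squeeze_zero' (Eventually.of_forall fun n => by positivity) ?_ h1
  filter_upwards [(tendsto_div_rpow_of_tendsto hh_pos hp hN).eventually_le_const one_pos,
    eventually_ge_atTop 1] with n hn hn1
  have hn0 : (1 : ℝ) ≤ n := by exact_mod_cast hn1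
  have hh := hh_pos n
  rw [div_le_one (by positivity)] at hn
  have hcard : ((Finset.Icc (0 : ℤ) n).card : ℝ) = n + 1 := by
    rw [Int.card_Icc]
    have : ((n : ℤ) + 1 - 0).toNat = n + 1 := by omega
    rw [this]; push_cast; ring
  rw [hcard]
  calc ((n : ℝ) + 1) * Real.exp (-c * (n * h n))
      ≤ 2 * (n * h n) ^ p * Real.exp (-c * (n * h n)) :=
        mul_le_mul_of_nonneg_right (by linarith) (Real.exp_pos _).le
    _ = _ := mul_assoc _ _ _

end LocallyStationaryAR

/-! ### Pointwise and uniform consistency -/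

open LocallyStationaryAR in
theorem mainTheorem7 {Ω : Type*} [MeasurableSpace Ω] (μ : Measure Ω) [IsProbabilityMeasure μ]
    -- i.i.d. innovations with finite first moment
    (ξ : ℤ → Ω → ℝ) (hξ_meas : ∀ t, Measurable (ξ t)) (hξ_indep : iIndepFun ξ μ)
    (hξ_ident : ∀ t, IdentDistrib (ξ t) (ξ 0) μ μ) (hξ_L1 : MemLp (ξ 0) 1 μ)
    -- identifiability for the absolute value contrast
    (hξ_median : ∀ m : ℝ, IsMedian μ (ξ 0) m ↔ m = 0)
    (hξ_nonzero : ¬ (∀ᵐ ω ∂μ, ξ 0 ω = 0))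
    -- parameters in `Θ = [-r, r]`, locally stationary
    (r : ℝ) (hr0 : 0 < r) (hr1 : r < 1) (ρ : ℝ) (hρ0 : 0 < ρ) (hρ1 : ρ ≤ 1)
    (θ : ℕ → ℕ → ℝ) (hθ : ∀ n t : ℕ, 1 ≤ t → t ≤ n → θ n t ∈ Set.Icc (-r) r)
    (θstar : ℝ → ℝ) (hLS : LocallyStationary ρ θ θstar)
    -- kernel, bandwidths, estimator
    (K : ℝ → ℝ) (hK : IsLocalizingKernel K)
    (h : ℕ → ℝ) (hh_pos : ∀ n, 0 < h n) (hh_lim : Tendsto h atTop (𝓝 0))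
    (θhat : ℕ → ℝ → Ω → ℝ)
    (hθhat : IsLocalizedLAVEstimator r K h (tvAR1 θ ξ) θhat) :
    -- consistency at every point
    (Tendsto (fun n : ℕ => (n : ℝ) * h n) atTop atTop →
      ∀ u ∈ Set.Ioo (0 : ℝ) 1,
        TendstoInMeasure μ (fun n ω => θhat n u ω) atTop (fun _ => θstar u)) ∧
    -- uniform consistency
    (∀ p : ℝ, 1 < p → MemLp (ξ 0) (ENNReal.ofReal p) μ →
      Tendsto (fun n : ℕ => (n : ℝ) ^ (1 - 1 / p) * h n) atTop atTop →
      ∀ ε : ℝ, 0 < ε →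
        TendstoInMeasure μ
          (fun n ω => ⨆ u : Set.Icc ε (1 - ε), |θhat n u ω - θstar u|) atTop (fun _ => 0)) := by
  have hint : ∀ t, Integrable (ξ t) μ := fun t =>
    (hξ_ident t).integrable_iff.2 (memLp_one_iff_integrable.1 hξ_L1)
  refine ⟨fun hN u hu => ?_, fun p hp hLp hN ε hε => ?_⟩
  · rw [tendstoInMeasure_iff_dist]
    intro η hη
    have h1 := tendsto_measure_exists_abs_sub_ge hξ_meas hξ_indep hξ_ident hint hξ_median
      hξ_nonzero hr0 hr1 hρ0 hθ hLS hK hh_pos hh_lim hN hθhat (ε := min u (1 - u))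
      (lt_min hu.1 (sub_pos.2 hu.2)) (U := {u})
      (singleton_subset_iff.2 ⟨min_le_left _ _, by linarith [min_le_right u (1 - u)]⟩)
      (negligibleTails_singleton hξ_meas hξ_ident hint hN u) (fun n => {⌊(n : ℝ) * u⌋})
      (fun n v hv => by rw [mem_singleton_iff.1 hv]; exact Finset.mem_singleton_self _)
      (fun c hc => by
        simp only [Finset.card_singleton, Nat.cast_one, one_mul]
        exact Real.tendsto_exp_atBot.comp (hN.const_mul_atTop_of_neg (by linarith))) hη
    simpa [Real.dist_eq] using h1
  · rw [tendstoInMeasure_iff_dist]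
    intro η hη
    have h1 := tendsto_measure_exists_abs_sub_ge hξ_meas hξ_indep hξ_ident hint hξ_median
      hξ_nonzero hr0 hr1 hρ0 hθ hLS hK hh_pos hh_lim
      (tendsto_natCast_mul_of_tendsto_rpow hh_pos hp hN) hθhat hε (U := Icc ε (1 - ε)) Subset.rfl
      (negligibleTails_of_memLp hξ_meas hξ_indep hξ_ident hint hh_pos hh_lim hp hLp hN
        (Icc_subset_Icc hε.le (by linarith))) (fun n => Finset.Icc 0 (n : ℤ))
      (fun n u hu => by
        have hn : (0 : ℝ) ≤ n := n.cast_nonneg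
        have hu0 : 0 ≤ u := hε.le.trans hu.1
        rw [Finset.mem_Icc]
        refine ⟨Int.floor_nonneg.2 (by positivity), Int.floor_le_iff.2 ?_⟩
        push_cast
        nlinarith [hu.2])
      (fun c hc => tendsto_card_mul_exp_neg hh_pos hp hN hc) (half_pos hη)
    refine tendsto_of_tendsto_of_tendsto_of_le_of_le tendsto_const_nhds h1
      (fun n => zero_le) fun n => measure_mono fun ω hω => ?_
    by_contra hcon
    simp only [mem_ofPred_eq, not_exists, not_and, not_le] at hcon
    -- Bounds below `η / 2` at every `u` leave room for the passage to the supremum. Nonnegativity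
    -- of `η / 2` covers `ε > 1/2`, where the index set is empty and the supremum is `0` by
    -- convention.
    have h2 : (⨆ u : Icc ε (1 - ε), |θhat n u ω - θstar u|) ≤ η / 2 :=
      Real.iSup_le (fun u => (hcon u u.2).le) (by positivity)
    have h3 : 0 ≤ ⨆ u : Icc ε (1 - ε), |θhat n u ω - θstar u| :=
      Real.iSup_nonneg fun u => abs_nonneg _
    simp only [mem_ofPred_eq, Real.dist_eq, sub_zero, abs_of_nonneg h3] at hω
    linarith
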